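/- Let $H$ be a complex inner product space (for example, the complexification of a separable real Hilbert space), with $\langle\cdot,\cdot\rangle$ linear in the second and conjugate-linear in the first variable, and let $x\mapsto\bar x$ be a self-adjoint involution of $H$, that is, a $\mathbb C$-linear map with $\overline{\bar x}=x$ and $\langle \bar x,y\rangle=\langle x,\bar y\rangle$. Let $\alpha,q\in(-1,1)$, with the convention $0^0=1$. Let $\Sigma(n)$ be the group of bijections $\sigma$ of $\{\pm1,\dots,\pm n\}$ with $\sigma(-k)=-\sigma(k)$. It is generated by $\pi_0=(1,-1)$ and $\pi_i=(i,i+1)$, $1\le i\le n-1$ (with $\pi_i$ also exchanging $-i$ and $-(i+1)$). Let $l_1(\sigma)$ be the number of occurrences of $\pi_0$, and $l_2(\sigma)$ the number of occurrences of $\pi_1,\dots,\pi_{n-1}$, in an expression of minimal length of $\sigma$ as a product of generators; these numbers do not depend on the expression. The group $\Sigma(n)$ acts on the algebraic tensor power $H^{\otimes n}$: $\pi_0$ replaces $x_1$ in $x_1\otimes\cdots\otimes x_n$ by $\overline{x_1}$, and $\pi_i$ exchanges the factors $x_i$ and $x_{i+1}$. Put $$P^{(n)}_{\alpha,q}=\sum_{\sigma\in\Sigma(n)}\alpha^{l_1(\sigma)}q^{l_2(\sigma)}\,\sigma\quad(n\ge1),\qquad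 P^{(0)}_{\alpha,q}=\mathrm{id}.$$ On the algebraic full Fock space $\mathcal F=\bigoplus_{n\ge0}H^{\otimes n}$, where $H^{\otimes0}=\mathbb C\Omega$, let $\langle\cdot,\cdot\rangle_{0,0}$ be the sesquilinear form with $\langle x_1\otimes\cdots\otimes x_m,y_1\otimes\cdots\otimes y_n\rangle_{0,0}=\delta_{m,n}\prod_{i=1}^n\langle x_i,y_i\rangle$, and let $\langle f,g\rangle_{\alpha,q}=\langle f,P_{\alpha,q}g\rangle_{0,0}$, where $P_{\alpha,q}=\bigoplus_n P^{(n)}_{\alpha,q}$. For $x\in H$ let $b^*(x)$ be the right creation operator $x_1\otimes\cdots\otimes x_n\mapsto x_1\otimes\cdots\otimes x_n\otimes x$, $\Omega\mapsto x$. Let $N$ be the number operator ($Nf=nf$ for $f\in H^{\otimes n}$), and for real $s$ define operators that vanish on $\Omega$ and satisfy, for $n\ge1$, $$r_s(x)(x_1\otimes\cdots\otimes x_n)=\sum_{k=1}^n s^{n-k}\langle x,x_k\rangle\,x_1\otimes\cdots\otimes\check x_k\otimes\cdots\otimes x_n,$$ $$\ell_s(x)(x_1\otimes\cdots\otimes x_n)=\sum_{k=1}^n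 s^{k-1}\langle x,x_k\rangle\,x_1\otimes\cdots\otimes\check x_k\otimes\cdots\otimes x_n,$$ where $\check x_k$ means that the factor $x_k$ is omitted. Then, for every $x\in H$, the operator $b^*(x)$ has exactly one adjoint $b(x)$ on $\mathcal F$ with respect to $\langle\cdot,\cdot\rangle_{\alpha,q}$, that is, exactly one linear operator $b(x)$ on $\mathcal F$ with $\langle f,b(x)g\rangle_{\alpha,q}=\langle b^*(x)f,g\rangle_{\alpha,q}$ for all $f,g\in\mathcal F$, and $$b(x)=r_q(x)+\alpha\,\ell_q(\bar x)\,q^{N-1}.$$ (For $q=0$ the undefined value of $q^{N-1}$ on $\Omega$ is immaterial, since $\ell_q(\bar x)\Omega=0$.) Moreover, $r_0(x)$ is the free right annihilation operator ($x_1\otimes\cdots\otimes x_n\mapsto\langle x,x_n\rangle\,x_1\otimes\cdots\otimes x_{n-1}$ for $n\ge1$, $\Omega\mapsto0$), $\ell_0(x)$ is the free left annihilation operator ($x_1\otimes\cdots\otimes x_n\mapsto\langle x,x_1\rangle\,x_2\otimes\cdots\otimes x_n$ for $n\ge1$, $\Omega\mapsto0$), and $\ell_q(x)=r_{1/q}(x)\,q^{N-1}$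 if $q\ne0$. -/

import Mathlib

namespace TypeB

open scoped TensorProduct DirectSum

/-! ## The hyperoctahedral group -/

/-- The `2n` points `{±1, …, ±n}`: the pair `(k, ε)` stands for the point `ε (k + 1)`. -/
abbrev SignedPoint (n : ℕ) : Type := Fin n × ℤˣ

/-- The hyperoctahedral group `Σ(n)`: the bijections `σ` of `{±1, …, ±n}` with `σ(-p) = -σ(p)`;
the product is composition. -/
def hyperoctahedral (n : ℕ) : Subgroup (Equiv.Perm (SignedPoint n)) where
  carrier := {σ | ∀ k ε, σ (k, -ε) = ((σ (k, ε)).1, -(σ (k, ε)).2)}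
  one_mem' := by intro k ε; rfl
  mul_mem' := by
    intro σ τ hσ hτ k ε
    have h := hσ (τ (k, ε)).1 (τ (k, ε)).2
    rw [Equiv.Perm.mul_apply, Equiv.Perm.mul_apply, hτ k ε]
    exact h
  inv_mem' := by
    intro σ hσ k ε
    rw [Equiv.Perm.inv_eq_iff_eq]
    have h := hσ (σ⁻¹ (k, ε)).1 (σ⁻¹ (k, ε)).2
    have e : σ (σ⁻¹ (k, ε)) = (k, ε) := σ.apply_symm_apply _
    rw [Prod.mk.eta, e] at h
    exact h.symm

noncomputable instance (n : ℕ) : Fintype (hyperoctahedral n) := Fintype.ofFinite _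

theorem apply_neg {n : ℕ} (σ : hyperoctahedral n) (k : Fin n) (ε : ℤˣ) :
    σ.1 (k, -ε) = ((σ.1 (k, ε)).1, -(σ.1 (k, ε)).2) := σ.2 k ε

theorem apply_eq {n : ℕ} (σ : hyperoctahedral n) (k : Fin n) (ε : ℤˣ) :
    σ.1 (k, ε) = ((σ.1 (k, 1)).1, ε * (σ.1 (k, 1)).2) := by
  rcases Int.units_eq_one_or ε with rfl | rfl
  · simp
  · rw [apply_neg σ k 1]; simp

/-- The sign change `(k, -k)`. -/
def signFlip {n : ℕ} (k : Fin n) : hyperoctahedral n :=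
  ⟨Equiv.swap (k, 1) (k, -1), by
    intro j ε
    rcases Int.units_eq_one_or ε with rfl | rfl <;> by_cases h : j = k
    · subst h; simp
    · rw [Equiv.swap_apply_of_ne_of_ne, Equiv.swap_apply_of_ne_of_ne] <;> simp [h]
    · subst h; simp
    · rw [Equiv.swap_apply_of_ne_of_ne, Equiv.swap_apply_of_ne_of_ne] <;> simp [h]⟩

/-- The embedding of the symmetric group `S(n)` in `Σ(n)`. -/
def ofPerm {n : ℕ} : Equiv.Perm (Fin n) →* hyperoctahedral n where
  toFun τ := ⟨τ.prodCongr (Equiv.refl ℤˣ), by intro k ε; rfl⟩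
  map_one' := rfl
  map_mul' _ _ := rfl

theorem ofPerm_apply {n : ℕ} (τ : Equiv.Perm (Fin n)) (k : Fin n) (ε : ℤˣ) :
    (ofPerm τ).1 (k, ε) = (τ k, ε) := rfl

/-- The Coxeter generators `π_0 = (1, -1)` and `π_i = (i, i + 1)` for `1 ≤ i ≤ n - 1`, where
the point `i` of `{1, …, n}` is written `i - 1` in `Fin n`. -/
def gen {n : ℕ} (i : Fin n) : hyperoctahedral n :=
  if i.val = 0 then signFlip i
  else ofPerm (Equiv.swap ⟨i.val - 1, lt_of_le_of_lt (Nat.sub_le _ _) i.isLt⟩ i)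

/-- `w = [i_1, …, i_k]` is an irreducible form `σ = π_{i_1} ⋯ π_{i_k}` of `σ`: no word in the
generators that represents `σ` is shorter. -/
def IsReducedWord {n : ℕ} (σ : hyperoctahedral n) (w : List (Fin n)) : Prop :=
  (w.map gen).prod = σ ∧ ∀ w' : List (Fin n), (w'.map gen).prod = σ → w.length ≤ w'.length

theorem ofPerm_mem (n : ℕ) (τ : Equiv.Perm (Fin n)) :
    ofPerm τ ∈ Submonoid.closure (Set.range (gen : Fin n → hyperoctahedral n)) := by
  cases n with
  | zero =>
    have : τ = 1 := Subsingleton.elim _ _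
    rw [this, map_one]; exact one_mem _
  | succ m =>
    have h : τ ∈ Submonoid.closure
        (Set.range fun i : Fin m => Equiv.swap i.castSucc i.succ) := by
      rw [Equiv.Perm.mclosure_swap_castSucc_succ]; trivial
    refine Submonoid.closure_induction (motive := fun τ _ => ofPerm τ ∈ _) ?_ ?_ ?_ h
    · rintro _ ⟨i, rfl⟩
      refine Submonoid.subset_closure ⟨i.succ, ?_⟩
      simp only [gen, Fin.val_succ, Nat.add_eq_zero_iff, one_ne_zero, and_false, if_false]
      rfl
    · rw [map_one]; exact one_mem _
    · intro a b _ _ ha hb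
      rw [map_mul]; exact mul_mem ha hb

theorem signFlip_mem {n : ℕ} (k : Fin n) :
    signFlip k ∈ Submonoid.closure (Set.range (gen : Fin n → hyperoctahedral n)) := by
  have hn : 0 < n := lt_of_le_of_lt (Nat.zero_le _) k.isLt
  set z : Fin n := ⟨0, hn⟩ with hz
  have hg : gen z = signFlip z := by simp [gen, hz]
  have h : signFlip k = ofPerm (Equiv.swap z k) * gen z * ofPerm (Equiv.swap z k) := by
    rw [hg]
    apply Subtype.ext
    have := Equiv.swap_apply_apply ((Equiv.swap z k).prodCongr (Equiv.refl ℤˣ)) (z, 1) (z, -1)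
    simp only [Equiv.prodCongr_apply, Prod.map_apply, Equiv.swap_apply_left,
      Equiv.refl_apply] at this
    simp only [signFlip, Subgroup.coe_mul]
    rw [this]
    congr 1
  rw [h]
  exact mul_mem (mul_mem (ofPerm_mem n _) (Submonoid.subset_closure ⟨z, rfl⟩)) (ofPerm_mem n _)

/-- The permutation `k ↦ |σ(k)|` of `{1, …, n}` underlying `σ ∈ Σ(n)`. -/
def absPerm {n : ℕ} (σ : hyperoctahedral n) : Equiv.Perm (Fin n) where
  toFun k := (σ.1 (k, 1)).1
  invFun k := (σ⁻¹.1 (k, 1)).1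
  left_inv k := by
    have h : σ⁻¹.1 (σ.1 (k, 1)) = (k, 1) := σ.1.symm_apply_apply _
    rw [← Prod.mk.eta (p := σ.1 (k, 1)), apply_eq] at h
    exact congrArg Prod.fst h
  right_inv k := by
    have h : σ.1 (σ⁻¹.1 (k, 1)) = (k, 1) := σ.1.apply_symm_apply _
    rw [← Prod.mk.eta (p := σ⁻¹.1 (k, 1)), apply_eq] at h
    exact congrArg Prod.fst h

theorem mem_closure_gen {n : ℕ} (σ : hyperoctahedral n) :
    σ ∈ Submonoid.closure (Set.range (gen : Fin n → hyperoctahedral n)) := by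
  suffices H : ∀ (m : ℕ) (σ : hyperoctahedral n),
      (Finset.univ.filter fun k => (σ.1 (k, 1)).2 = -1).card = m →
      σ ∈ Submonoid.closure (Set.range (gen : Fin n → hyperoctahedral n)) from H _ σ rfl
  intro m
  induction m with
  | zero =>
    intro σ h
    have h1 : ∀ k, (σ.1 (k, 1)).2 = 1 := by
      intro k
      have := Finset.filter_eq_empty_iff.1 (Finset.card_eq_zero.1 h) (Finset.mem_univ k)
      exact (Int.units_eq_one_or _).resolve_right this
    have : σ = ofPerm (absPerm σ) := by
      apply Subtype.ext
      apply Equiv.ext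
      rintro ⟨k, ε⟩
      rw [apply_eq, h1 k, ofPerm_apply, mul_one]
      rfl
    rw [this]; exact ofPerm_mem n _
  | succ m ih =>
    intro σ h
    obtain ⟨k, hk⟩ := Finset.card_pos.1 (by rw [h]; exact Nat.succ_pos m)
    have hk' := (Finset.mem_filter.1 hk).2
    have hs : (σ * signFlip k) * signFlip k = σ := by
      apply Subtype.ext
      simp [signFlip, mul_assoc]
    rw [← hs]
    refine mul_mem (ih _ ?_) (signFlip_mem k)
    have : (Finset.univ.filter fun j => ((σ * signFlip k).1 (j, 1)).2 = -1)
        = (Finset.univ.filter fun j => (σ.1 (j, 1)).2 = -1).erase k := by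
      ext j
      have key : (σ * signFlip k).1 (j, 1) = σ.1 (Equiv.swap (k, 1) (k, -1) (j, 1)) := rfl
      rw [Finset.mem_erase, Finset.mem_filter, Finset.mem_filter, key]
      by_cases hj : j = k
      · subst hj
        rw [Equiv.swap_apply_left, apply_neg, hk']
        simp
      · rw [Equiv.swap_apply_of_ne_of_ne] <;> simp [hj]
    rw [this, Finset.card_erase_of_mem hk, h]
    rfl

theorem exists_reducedWord {n : ℕ} (σ : hyperoctahedral n) : ∃ w, IsReducedWord σ w := by
  classical
  have hex : ∃ m, ∃ w : List (Fin n), w.length = m ∧ (w.map gen).prod = σ := by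
    obtain ⟨l, hl, hp⟩ := Submonoid.exists_list_of_mem_closure (mem_closure_gen σ)
    obtain ⟨w, rfl⟩ : ∃ w : List (Fin n), w.map gen = l := by
      have : l ∈ Set.range (List.map (gen : Fin n → hyperoctahedral n)) := by
        rw [Set.range_list_map]; exact hl
      exact this
    exact ⟨_, w, rfl, hp⟩
  obtain ⟨w, hw, hp⟩ := Nat.find_spec hex
  exact ⟨w, hp, fun w' hw' => hw ▸ Nat.find_min' hex ⟨w', rfl, hw'⟩⟩

/-- A chosen irreducible form of `σ`. -/
noncomputable def reducedWord {n : ℕ} (σ : hyperoctahedral n) : List (Fin n) :=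
  (exists_reducedWord σ).choose

/-- `l₁(σ)`: the number of `π_0` in an irreducible form of `σ`. All irreducible forms of `σ`
give the same number, so the choice of the form does not matter; the same holds for `l₂(σ)`. -/
noncomputable def lOne {n : ℕ} (σ : hyperoctahedral n) : ℕ :=
  (reducedWord σ).countP fun i => i.val = 0

/-- `l₂(σ)`: the number of `π_i`, `1 ≤ i ≤ n - 1`, in an irreducible form of `σ`. -/
noncomputable def lTwo {n : ℕ} (σ : hyperoctahedral n) : ℕ :=
  (reducedWord σ).countP fun i => i.val ≠ 0

/-! ## The algebraic full Fock space -/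

section Fock

variable {H : Type*} [NormedAddCommGroup H] [InnerProductSpace ℂ H]

/-- The operator by which a sign acts on `H`: `id` for the sign `1` and the involution `J` for the sign `-1`. -/
def signOp (J : H →ₗ[ℂ] H) (ε : ℤˣ) : H →ₗ[ℂ] H := if ε = 1 then LinearMap.id else J

/-- The action of `σ ∈ Σ(n)` on `H^{⊗n}`. With `x_{-k} := J x_k`, it sends `x_1 ⊗ ⋯ ⊗ x_n` to
`x_{σ⁻¹(1)} ⊗ ⋯ ⊗ x_{σ⁻¹(n)}`. -/
noncomputable def act (J : H →ₗ[ℂ] H) {n : ℕ} (σ : hyperoctahedral n) :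
    (⨂[ℂ]^n H) →ₗ[ℂ] (⨂[ℂ]^n H) :=
  PiTensorProduct.map (fun i => signOp J (σ⁻¹.1 (i, 1)).2) ∘ₗ
    (PiTensorProduct.reindex ℂ (fun _ : Fin n => H) (absPerm σ)).toLinearMap

theorem act_tprod (J : H →ₗ[ℂ] H) {n : ℕ} (σ : hyperoctahedral n) (v : Fin n → H) :
    act J σ (PiTensorProduct.tprod ℂ v) = PiTensorProduct.tprod ℂ
      fun i => signOp J (σ⁻¹.1 (i, 1)).2 (v (σ⁻¹.1 (i, 1)).1) := by
  have h : PiTensorProduct.reindex ℂ (fun _ : Fin n => H) (absPerm σ)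
      (PiTensorProduct.tprod ℂ v) =
      PiTensorProduct.tprod ℂ (fun i => v ((absPerm σ).symm i)) :=
    PiTensorProduct.reindex_tprod (absPerm σ) v
  rw [act, LinearMap.comp_apply, LinearEquiv.coe_coe, h]
  exact PiTensorProduct.map_tprod _ _

theorem act_one (J : H →ₗ[ℂ] H) {n : ℕ} :
    act J (1 : hyperoctahedral n) = LinearMap.id := by
  apply PiTensorProduct.ext
  ext v
  simp only [LinearMap.compMultilinearMap_apply, act_tprod, LinearMap.id_apply]
  congr 1

theorem act_mul (J : H →ₗ[ℂ] H) (hJ : Function.Involutive J) {n : ℕ}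
    (σ τ : hyperoctahedral n) : act J (σ * τ) = act J σ ∘ₗ act J τ := by
  have hs : ∀ (ε δ : ℤˣ) (x : H), signOp J ε (signOp J δ x) = signOp J (ε * δ) x := by
    intro ε δ x
    rcases Int.units_eq_one_or ε with rfl | rfl <;>
      rcases Int.units_eq_one_or δ with rfl | rfl <;> simp [signOp, hJ x]
  apply PiTensorProduct.ext
  ext v
  simp only [LinearMap.compMultilinearMap_apply, act_tprod, LinearMap.comp_apply, hs]
  congr 1
  funext i
  have h : (σ * τ)⁻¹.1 (i, 1) = τ⁻¹.1 ((σ⁻¹.1 (i, 1)).1, (σ⁻¹.1 (i, 1)).2) := by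
    rw [mul_inv_rev]; rfl
  rw [h, apply_eq τ⁻¹]

/-- `π_0 (x_1 ⊗ ⋯ ⊗ x_n) = x̄_1 ⊗ x_2 ⊗ ⋯ ⊗ x_n`. -/
theorem act_gen_zero (J : H →ₗ[ℂ] H) {n : ℕ} (i : Fin n) (hi : i.val = 0) (v : Fin n → H) :
    act J (gen i) (PiTensorProduct.tprod ℂ v) =
      PiTensorProduct.tprod ℂ (Function.update v i (J (v i))) := by
  rw [act_tprod]
  congr 1
  funext j
  have hg : (gen i)⁻¹.1 = Equiv.swap (i, 1) (i, -1) := by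
    simp [gen, hi, signFlip]
  rw [hg]
  by_cases hj : j = i
  · subst hj
    simp [signOp]
  · rw [Equiv.swap_apply_of_ne_of_ne] <;> simp [signOp, hj]

/-- `π_i` with `i ≥ 1` exchanges the tensor factors `i` and `i + 1`. -/
theorem act_gen_pos (J : H →ₗ[ℂ] H) {n : ℕ} (i : Fin n) (hi : i.val ≠ 0) (v : Fin n → H) :
    act J (gen i) (PiTensorProduct.tprod ℂ v) = PiTensorProduct.tprod ℂ
      (v ∘ Equiv.swap ⟨i.val - 1, lt_of_le_of_lt (Nat.sub_le _ _) i.isLt⟩ i) := by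
  rw [act_tprod]
  congr 1
  funext j
  rw [gen, if_neg hi, ← map_inv, Equiv.swap_inv, ofPerm_apply]
  simp [signOp]

/-- The type B symmetrization operator
`P^{(n)} = ∑_{σ ∈ Σ(n)} α^{l₁(σ)} q^{l₂(σ)} σ` on `H^{⊗n}`. -/
noncomputable def symmetrizer (J : H →ₗ[ℂ] H) (α q : ℝ) (n : ℕ) :
    (⨂[ℂ]^n H) →ₗ[ℂ] (⨂[ℂ]^n H) :=
  ∑ σ : hyperoctahedral n, ((α ^ lOne σ * q ^ lTwo σ : ℝ) : ℂ) • act J σ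

/-- The linear functional `y_1 ⊗ ⋯ ⊗ y_n ↦ ∏ ⟨v_i, y_i⟩` on `H^{⊗n}`. -/
noncomputable def innerFunctional {n : ℕ} (v : Fin n → H) : (⨂[ℂ]^n H) →ₗ[ℂ] ℂ :=
  PiTensorProduct.lift
    ((MultilinearMap.mkPiAlgebra ℂ (Fin n) ℂ).compLinearMap fun i => innerₛₗ ℂ (v i))

theorem innerFunctional_tprod {n : ℕ} (v y : Fin n → H) :
    innerFunctional v (PiTensorProduct.tprod ℂ y) = ∏ i, inner ℂ (v i) (y i) := by
  simp [innerFunctional]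

/-- The inner product of `H^{⊗n}`, conjugate-linear in the first variable, with
`⟨x_1 ⊗ ⋯ ⊗ x_n, y_1 ⊗ ⋯ ⊗ y_n⟩ = ∏ ⟨x_i, y_i⟩`. -/
noncomputable def tensorInner (n : ℕ) : (⨂[ℂ]^n H) →ₗ⋆[ℂ] (⨂[ℂ]^n H) →ₗ[ℂ] ℂ where
  toFun := PiTensorProduct.liftAddHom
    (fun p : ℂ × (Fin n → H) => (starRingEnd ℂ) p.1 • innerFunctional p.2)
    (by
      intro r f i hf
      apply PiTensorProduct.ext
      ext y
      simp only [LinearMap.compMultilinearMap_apply, LinearMap.smul_apply, innerFunctional_tprod,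
        LinearMap.zero_apply]
      rw [Finset.prod_eq_zero (Finset.mem_univ i) (by rw [hf, inner_zero_left]), smul_zero])
    (by intro f; simp)
    (by
      intro _ r f i a b
      rw [← smul_add]
      congr 1
      apply PiTensorProduct.ext
      ext y
      simp only [LinearMap.compMultilinearMap_apply, LinearMap.add_apply, innerFunctional_tprod]
      simp only [← Finset.mul_prod_erase _ _ (Finset.mem_univ i), Function.update_self,
        inner_add_left, add_mul]
      congr 2 <;>
      exact Finset.prod_congr rfl fun j hj => by
        rw [Function.update_of_ne (Finset.ne_of_mem_erase hj),
          Function.update_of_ne (Finset.ne_of_mem_erase hj)])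
    (by intro r r' f; rw [map_add, add_smul])
    (by
      intro _ r f i c
      rw [map_mul, mul_comm, mul_smul]
      congr 1
      apply PiTensorProduct.ext
      ext y
      simp only [LinearMap.compMultilinearMap_apply, LinearMap.smul_apply, innerFunctional_tprod]
      simp only [← Finset.mul_prod_erase _ _ (Finset.mem_univ i), Function.update_self,
        inner_smul_left, smul_eq_mul, mul_assoc]
      congr 2
      exact Finset.prod_congr rfl fun j hj => by
        rw [Function.update_of_ne (Finset.ne_of_mem_erase hj)])
  map_add' := map_add _
  map_smul' := by
    intro c z
    induction z using PiTensorProduct.induction_on' with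
    | tprodCoeff r f =>
      rw [PiTensorProduct.smul_tprodCoeff']
      simp only [PiTensorProduct.tprodCoeff, PiTensorProduct.liftAddHom]
      erw [AddCon.lift_coe, AddCon.lift_coe]
      simp [mul_smul]
    | add a b ha hb => rw [smul_add, map_add, ha, hb, map_add, smul_add]

theorem tensorInner_tprod {n : ℕ} (x y : Fin n → H) :
    tensorInner n (PiTensorProduct.tprod ℂ x) (PiTensorProduct.tprod ℂ y) =
      ∏ i, inner ℂ (x i) (y i) := by
  rw [← innerFunctional_tprod, PiTensorProduct.tprod_eq_tprodCoeff_one]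
  simp only [tensorInner, LinearMap.coe_mk, AddHom.coe_mk, PiTensorProduct.tprodCoeff,
    PiTensorProduct.liftAddHom]
  erw [AddCon.lift_coe]
  simp

variable (H) in
/-- The algebraic full Fock space `⨁_n H^{⊗n}` (no completion). -/
abbrev Fock : Type _ := ⨁ n : ℕ, ⨂[ℂ]^n H

/-- The form `⟨f, g⟩_{α,q} = ⟨f, P_{α,q} g⟩_{0,0} = ∑_n ⟨f_n, P^{(n)}_{α,q} g_n⟩` on the Fock
space; the sum runs over the degrees `n` with `f_n ≠ 0`. -/
noncomputable def fockInner (J : H →ₗ[ℂ] H) (α q : ℝ) (f g : Fock H) : ℂ := by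
  classical
  exact ∑ n ∈ DFinsupp.support f, tensorInner n (f n) (symmetrizer J α q n (g n))

/-- `x_1 ⊗ ⋯ ⊗ x_n ↦ x_1 ⊗ ⋯ ⊗ x_n ⊗ x`. -/
noncomputable def appendRight (x : H) (n : ℕ) : (⨂[ℂ]^n H) →ₗ[ℂ] (⨂[ℂ]^(n + 1) H) :=
  PiTensorProduct.lift (LinearMap.compMultilinearMap (LinearMap.applyₗ x)
    (PiTensorProduct.tprod ℂ (s := fun _ : Fin (n + 1) => H)).curryRight)

theorem appendRight_tprod (x : H) {n : ℕ} (v : Fin n → H) :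
    appendRight x n (PiTensorProduct.tprod ℂ v) =
      PiTensorProduct.tprod ℂ (Fin.snoc v x : Fin (n + 1) → H) := by
  simp [appendRight]

/-- The free right creation operator `r*(x)`, which is also the type B creation operator. -/
noncomputable def creation (x : H) : Fock H →ₗ[ℂ] Fock H :=
  DirectSum.toModule ℂ ℕ (Fock H) fun n =>
    DirectSum.lof ℂ ℕ (fun n => ⨂[ℂ]^n H) (n + 1) ∘ₗ appendRight x n

/-- `T` is the type B annihilation operator of `x`, i.e. the adjoint of the creation operator
with respect to `⟨·,·⟩_{α,q}`. -/
def IsAnnihilation (J : H →ₗ[ℂ] H) (α q : ℝ) (x : H) (T : Fock H →ₗ[ℂ] Fock H) : Prop :=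
  ∀ f g : Fock H, fockInner J α q f (T g) = fockInner J α q (creation x f) g

/-- `x_1 ⊗ ⋯ ⊗ x_{n+1} ↦ ⟨x, x_k⟩ x_1 ⊗ ⋯ ⊗ x̌_k ⊗ ⋯ ⊗ x_{n+1}` (the factor `x_k` is omitted). -/
noncomputable def contract (x : H) {n : ℕ} (k : Fin (n + 1)) :
    (⨂[ℂ]^(n + 1) H) →ₗ[ℂ] (⨂[ℂ]^n H) :=
  PiTensorProduct.lift (LinearMap.uncurryMid k
    (LinearMap.smulRight (innerₛₗ ℂ x) (PiTensorProduct.tprod ℂ (s := fun _ : Fin n => H))))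

theorem contract_tprod (x : H) {n : ℕ} (k : Fin (n + 1)) (v : Fin (n + 1) → H) :
    contract x k (PiTensorProduct.tprod ℂ v) =
      inner ℂ x (v k) • PiTensorProduct.tprod ℂ (fun i => v (k.succAbove i)) := by
  simp [contract, LinearMap.uncurryMid]
  rfl

/-- The operator on the Fock space that vanishes on the vacuum and maps `H^{⊗(n+1)}` to `H^{⊗n}`
by `D n`. -/
noncomputable def lowering (D : ∀ n : ℕ, (⨂[ℂ]^(n + 1) H) →ₗ[ℂ] (⨂[ℂ]^n H)) :
    Fock H →ₗ[ℂ] Fock H :=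
  DirectSum.toModule ℂ ℕ (Fock H) fun n =>
    match n with
    | 0 => 0
    | n + 1 => DirectSum.lof ℂ ℕ (fun n => ⨂[ℂ]^n H) n ∘ₗ D n

/-- The free right annihilation operator `r(x)`, which removes the last factor. -/
noncomputable def freeRight (x : H) : Fock H →ₗ[ℂ] Fock H :=
  lowering fun n => contract x (Fin.last n)

/-- The free left annihilation operator, which removes the first factor. -/
noncomputable def freeLeft (x : H) : Fock H →ₗ[ℂ] Fock H :=
  lowering fun _ => contract x 0

/-- `r_q(x)`: on `H^{⊗(n+1)}` the `k`-th factor, `k = 0, …, n`, is removed with weight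
`q^{n-k}`. -/
noncomputable def rightAnnihilation (q : ℝ) (x : H) : Fock H →ₗ[ℂ] Fock H :=
  lowering fun n => ∑ k : Fin (n + 1), ((q : ℂ) ^ (n - k.val)) • contract x k

/-- `ℓ_q(x)`: on `H^{⊗(n+1)}` the `k`-th factor, `k = 0, …, n`, is removed with weight `q^k`. -/
noncomputable def leftAnnihilation (q : ℝ) (x : H) : Fock H →ₗ[ℂ] Fock H :=
  lowering fun n => ∑ k : Fin (n + 1), ((q : ℂ) ^ k.val) • contract x k

variable (H) in
/-- The function `φ(N)` of the number operator `N`: multiplication by `φ n` on `H^{⊗n}`. -/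
noncomputable def numberFun (φ : ℕ → ℂ) : Fock H →ₗ[ℂ] Fock H :=
  DirectSum.toModule ℂ ℕ (Fock H) fun n =>
    φ n • DirectSum.lof ℂ ℕ (fun n => ⨂[ℂ]^n H) n

variable (H) in
/-- The operator `q^{N-1}`. For `q = 0` it is `0` on the vacuum, where the exponent is `-1`. -/
noncomputable def qPowNumberSubOne (q : ℝ) : Fock H →ₗ[ℂ] Fock H :=
  numberFun H fun n => (q : ℂ) ^ ((n : ℤ) - 1)

end Fock

end TypeB

namespace TypeB

open scoped TensorProduct DirectSum Pointwise symmDiff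

/-!
The weight `α ^ l₁(σ) * q ^ l₂(σ)` is a product over the inversions of `σ`, the positive roots of
type `C_n` that `σ⁻¹` makes negative, with a factor `α` for each long root and `q` for each short
one. As the inversion set of `σ⁻¹ τ` is a translate of the symmetric difference of those of `σ`
and `τ`, the kernel `(σ, τ) ↦ weight (σ⁻¹ τ)` restricts a kernel `∏ i ∈ S ∆ T, c i` on sets of
roots. The latter is diagonalized by the Walsh matrix, with positive eigenvalues since `|c i| < 1`.
Hence the symmetrizers are injective, the form `⟨·,·⟩_{α,q}` separates points, and adjoints are
unique.

For the formula, the elements of `Σ(n + 1)` factor uniquely through the cosets of `Σ(n)` with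
additive lengths. The minimal representative that moves the point `k + 1` to the last place has
weight `q ^ (n - k)`, and the one that moves `-(k + 1)` there has weight `α * q ^ (n + k)`. Pairing
the last factor of the tensor with `x` therefore turns the symmetrizer of degree `n + 1` into the
one of degree `n` composed with the annihilation operator.
-/

section SignedPermutations

variable {n : ℕ}

/-! ## Signed points and roots -/

/-- The integer `ε (k + 1)` for which the pair `(k, ε)` stands. -/
def value (p : SignedPoint n) : ℤ := (p.2 : ℤ) * (p.1.val + 1)

theorem value_one (k : Fin n) : value (k, 1) = k.val + 1 := by
  simp [value]

theorem value_neg_one (k : Fin n) : value (k, -1) = -(k.val + 1 : ℤ) := by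
  simp [value]

theorem value_injective : Function.Injective (value (n := n)) := by
  rintro ⟨i, ε⟩ ⟨j, δ⟩ h
  rcases Int.units_eq_one_or ε with rfl | rfl <;> rcases Int.units_eq_one_or δ with rfl | rfl <;>
    simp only [value_one, value_neg_one] at h
  · rw [Fin.ext (by omega : i.val = j.val)]
  · omega
  · omega
  · rw [Fin.ext (by omega : i.val = j.val)]

theorem value_ne_zero (p : SignedPoint n) : value p ≠ 0 :=
  mul_ne_zero p.2.ne_zero (by omega)

theorem neg_le_value (p : SignedPoint n) : -(n : ℤ) ≤ value p := by
  obtain ⟨k, ε⟩ := p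
  rcases Int.units_eq_one_or ε with rfl | rfl <;>
    simp only [value_one, value_neg_one] <;> omega

theorem value_pos_iff {p : SignedPoint n} : 0 < value p ↔ p.2 = 1 := by
  obtain ⟨k, ε⟩ := p
  rcases Int.units_eq_one_or ε with rfl | rfl
  · simp only [value_one, iff_true]
    omega
  · simp only [value_neg_one, show (-1 : ℤˣ) ≠ 1 by decide, iff_false]
    omega

/-- The point `-p` of `{±1, …, ±n}`. -/
def antipode (p : SignedPoint n) : SignedPoint n := (p.1, -p.2)

theorem antipode_antipode (p : SignedPoint n) : antipode (antipode p) = p :=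
  Prod.ext rfl (neg_neg p.2)

theorem value_antipode (p : SignedPoint n) : value (antipode p) = -value p := by
  simp [value, antipode]

theorem apply_antipode (σ : hyperoctahedral n) (p : SignedPoint n) :
    σ.1 (antipode p) = antipode (σ.1 p) :=
  apply_neg σ p.1 p.2

theorem hyperoctahedral_ext {σ τ : hyperoctahedral n}
    (h : ∀ k, σ.1 (k, 1) = τ.1 (k, 1)) : σ = τ := by
  refine Subtype.ext (Equiv.ext ?_)
  rintro ⟨k, ε⟩
  rw [apply_eq, apply_eq τ, h]

theorem mul_apply (σ τ : hyperoctahedral n) (p : SignedPoint n) :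
    (σ * τ).1 p = σ.1 (τ.1 p) := rfl

theorem gen_inv (i : Fin n) : (gen i)⁻¹ = gen i := by
  unfold gen
  split_ifs
  · exact Subtype.ext (Equiv.swap_inv _ _)
  · rw [← map_inv, Equiv.swap_inv]

theorem gen_mul_self (i : Fin n) : gen i * gen i = 1 := by
  rw [← inv_mul_cancel (gen i), gen_inv]

theorem value_gen_of_eq_zero {i : Fin n} (hi : i.val = 0) (p : SignedPoint n) :
    value ((gen i).1 p) = if |value p| = 1 then -value p else value p := by
  have hgen : (gen i).1 = Equiv.swap (i, 1) (i, -1) := by rw [gen, if_pos hi]; rfl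
  rw [hgen, Equiv.swap_apply_def]
  simp only [← value_injective.eq_iff, apply_ite value, value_one, value_neg_one, hi]
  grind

theorem value_gen_of_ne_zero {i : Fin n} (hi : i.val ≠ 0) (p : SignedPoint n) :
    value ((gen i).1 p) = if value p = i then value p + 1 else if value p = i + 1 then value p - 1
      else if value p = -i then value p - 1 else if value p = -(i + 1) then value p + 1
      else value p := by
  obtain ⟨k, ε⟩ := p
  rw [gen, if_neg hi, ofPerm_apply, Equiv.swap_apply_def]
  rcases Int.units_eq_one_or ε with rfl | rfl <;>
    simp only [Fin.ext_iff, value_one, value_neg_one] <;> grind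

/-- The roots `e_p + e_q` of the root system of type `C_n`, where `e_{-p} = -e_p`; the long roots
`2 e_p` are the diagonal pairs, and the pairs `s(p, -p)`, which stand for `0`, are not excluded. -/
abbrev Root (n : ℕ) : Type := Sym2 (SignedPoint n)

/-- The height `⟨r, ρ⟩` of a root, where `ρ = (1, …, n)`; the positive roots are those of positive
height. -/
def height : Root n → ℤ :=
  Sym2.lift ⟨fun p q => value p + value q, fun _ _ => add_comm _ _⟩

theorem height_mk (p q : SignedPoint n) : height s(p, q) = value p + value q := rfl

theorem height_map_antipode (r : Root n) : height (r.map antipode) = -height r := by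
  induction r using Sym2.ind with
  | h p q => rw [Sym2.map_mk, height_mk, height_mk, value_antipode, value_antipode, neg_add]

theorem height_eq_zero_iff (p q : SignedPoint n) :
    height s(p, q) = 0 ↔ p = antipode q := by
  rw [height_mk, ← value_injective.eq_iff, value_antipode, add_eq_zero_iff_eq_neg]

theorem height_map_eq_zero_iff (σ : hyperoctahedral n) (r : Root n) :
    height (r.map σ.1) = 0 ↔ height r = 0 := by
  induction r using Sym2.ind with
  | h p q =>
    rw [Sym2.map_mk, height_eq_zero_iff, height_eq_zero_iff, ← apply_antipode,
      σ.1.injective.eq_iff]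

theorem map_antipode_map (σ : hyperoctahedral n) (r : Root n) :
    (r.map antipode).map σ.1 = (r.map σ.1).map antipode := by
  rw [Sym2.map_map, Sym2.map_map]
  exact Sym2.map_congr fun p _ => apply_antipode σ p

theorem Root.map_one (r : Root n) : r.map (1 : hyperoctahedral n).1 = r :=
  congrFun Sym2.map_id r

theorem Root.map_mul (σ τ : hyperoctahedral n) (r : Root n) :
    r.map (σ * τ).1 = (r.map τ.1).map σ.1 := by
  rw [Sym2.map_map]
  rfl

/-- The positive roots. -/
abbrev PosRoot (n : ℕ) : Type := {r : Root n // 0 < height r}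

/-- The positive one of the roots `r` and `-r`. -/
def absRoot (r : Root n) : Root n := if height r < 0 then r.map antipode else r

theorem absRoot_eq_or (r : Root n) : absRoot r = r ∨ absRoot r = r.map antipode := by
  unfold absRoot
  split_ifs
  · exact Or.inr rfl
  · exact Or.inl rfl

theorem height_absRoot (r : Root n) : height (absRoot r) = |height r| := by
  unfold absRoot
  split_ifs with h
  · rw [height_map_antipode, abs_of_neg h]
  · rw [abs_of_nonneg (not_lt.1 h)]

theorem absRoot_map_antipode {r : Root n} (h : height r ≠ 0) :
    absRoot (r.map antipode) = absRoot r := by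
  have hinv : (r.map antipode).map antipode = r := by
    rw [Sym2.map_map, (funext antipode_antipode : antipode ∘ antipode = id), Sym2.map_id, id]
  unfold absRoot
  rw [height_map_antipode, hinv]
  grind

/-- `Σ(n)` acts on the positive roots, regarded as pairs `±r` of roots. -/
instance : MulAction (hyperoctahedral n) (PosRoot n) where
  smul σ r := ⟨absRoot (r.1.map σ.1), by
    rw [height_absRoot, abs_pos]
    exact (height_map_eq_zero_iff σ r.1).not.2 r.2.ne'⟩
  one_smul r := Subtype.ext <| by
    change absRoot (r.1.map (1 : hyperoctahedral n).1) = r.1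
    rw [Root.map_one, absRoot, if_neg r.2.le.not_gt]
  mul_smul σ τ r := Subtype.ext <| by
    change absRoot (r.1.map (σ * τ).1) = absRoot ((absRoot (r.1.map τ.1)).map σ.1)
    rw [Root.map_mul]
    rcases absRoot_eq_or (r.1.map τ.1) with h | h <;> rw [h]
    rw [map_antipode_map, absRoot_map_antipode]
    rw [← Root.map_mul]
    exact (height_map_eq_zero_iff _ _).not.2 r.2.ne'

theorem coe_smul (σ : hyperoctahedral n) (r : PosRoot n) :
    (σ • r).1 = absRoot (r.1.map σ.1) := rfl

/-! ## Inversions -/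

/-- The positive roots that `σ⁻¹` makes negative. -/
def inversions (σ : hyperoctahedral n) : Finset (PosRoot n) :=
  Finset.univ.filter fun r => height (r.1.map σ⁻¹.1) < 0

theorem mem_inversions {σ : hyperoctahedral n} {r : PosRoot n} :
    r ∈ inversions σ ↔ height (r.1.map σ⁻¹.1) < 0 := by
  simp only [inversions, Finset.mem_filter_univ]

theorem inversions_one : inversions (1 : hyperoctahedral n) = ∅ := by
  refine Finset.eq_empty_of_forall_notMem fun r hr => ?_
  rw [mem_inversions, inv_one, Root.map_one] at hr
  exact hr.not_gt r.2

theorem inversions_mul (σ τ : hyperoctahedral n) :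
    inversions (σ * τ) = inversions σ ∆ (σ • inversions τ) := by
  ext r
  have hσ := (height_map_eq_zero_iff σ⁻¹ r.1).not.2 r.2.ne'
  have hτ := (height_map_eq_zero_iff τ⁻¹ (r.1.map σ⁻¹.1)).not.2 hσ
  rw [Finset.mem_symmDiff, ← Finset.inv_smul_mem_iff, mem_inversions, mem_inversions,
    mem_inversions, mul_inv_rev, Root.map_mul, coe_smul, absRoot]
  split_ifs with h
  · rw [map_antipode_map, height_map_antipode]
    omega
  · omega

/-- The simple root `α_i`: `α_0 = 2 e_1`, and `α_i = e_{i+1} - e_i` for `1 ≤ i ≤ n - 1`. -/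
def simpleRoot (i : Fin n) : PosRoot n :=
  ⟨s((i, 1), if i.val = 0 then (i, 1)
    else (⟨i.val - 1, lt_of_le_of_lt (Nat.sub_le _ _) i.isLt⟩, -1)), by
    rw [height_mk, value_one]
    split_ifs
    · rw [value_one]
      omega
    · rw [value_neg_one]
      dsimp only
      omega⟩

theorem coe_simpleRoot_of_eq_zero {i : Fin n} (hi : i.val = 0) :
    (simpleRoot i).1 = s((i, 1), (i, 1)) := by
  simp only [simpleRoot, if_pos hi]

theorem coe_simpleRoot_of_ne_zero {i : Fin n} (hi : i.val ≠ 0) :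
    (simpleRoot i).1 =
      s((i, 1), (⟨i.val - 1, lt_of_le_of_lt (Nat.sub_le _ _) i.isLt⟩, -1)) := by
  simp only [simpleRoot, if_neg hi]

theorem inversions_gen (i : Fin n) : inversions (gen i) = {simpleRoot i} := by
  ext ⟨r, hr⟩
  rw [mem_inversions, Finset.mem_singleton, Subtype.ext_iff, gen_inv]
  induction r using Sym2.ind with
  | h p q =>
    have hp := value_ne_zero p
    have hq := value_ne_zero q
    rw [height_mk] at hr
    rw [Sym2.map_mk, height_mk]
    by_cases hi : i.val = 0
    · rw [coe_simpleRoot_of_eq_zero hi, Sym2.eq_iff, value_gen_of_eq_zero hi,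
        value_gen_of_eq_zero hi]
      simp only [← value_injective.eq_iff, value_one, hi]
      grind
    · rw [coe_simpleRoot_of_ne_zero hi, Sym2.eq_iff, value_gen_of_ne_zero hi,
        value_gen_of_ne_zero hi]
      simp only [← value_injective.eq_iff, value_one, value_neg_one]
      grind

theorem eq_one_of_strictMono {σ : hyperoctahedral n} (hpos : ∀ k, 0 < value (σ.1 (k, 1)))
    (hmono : StrictMono fun k => value (σ.1 (k, 1))) : σ = 1 := by
  have sign_eq_one (k : Fin n) : (σ.1 (k, 1)).2 = 1 := value_pos_iff.1 (hpos k)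
  have habs : StrictMono fun k => (σ.1 (k, 1)).1 := by
    intro k l hkl
    have hlt := hmono hkl
    simp only [value, sign_eq_one, Units.val_one, one_mul, add_lt_add_iff_right, Nat.cast_lt]
      at hlt
    exact hlt
  exact hyperoctahedral_ext fun k => Prod.ext (le_antisymm habs.apply_le habs.le_apply)
    (sign_eq_one k)

theorem eq_one_of_simpleRoot_notMem {σ : hyperoctahedral n}
    (h : ∀ i, simpleRoot i ∉ inversions σ) : σ = 1 := by
  simp only [mem_inversions, not_lt] at h
  cases n with
  | zero => exact hyperoctahedral_ext fun k => k.elim0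
  | succ n =>
    have hzero : 0 < value (σ⁻¹.1 (0, 1)) := by
      have h0 := h 0
      rw [coe_simpleRoot_of_eq_zero rfl, Sym2.map_mk, height_mk] at h0
      have := value_ne_zero (σ⁻¹.1 (0, 1))
      omega
    have hstep (k : Fin n) : value (σ⁻¹.1 (k.castSucc, 1)) < value (σ⁻¹.1 (k.succ, 1)) := by
      have hk := h k.succ
      have hne := (height_map_eq_zero_iff σ⁻¹ _).not.2 (simpleRoot k.succ).2.ne'
      rw [coe_simpleRoot_of_ne_zero (Nat.succ_ne_zero k)] at hk hne
      have hneg : σ⁻¹.1 (k.castSucc, -1) = antipode (σ⁻¹.1 (k.castSucc, 1)) :=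
        apply_neg σ⁻¹ k.castSucc 1
      change height s(_, σ⁻¹.1 (k.castSucc, -1)) ≠ 0 at hne
      change 0 ≤ height s(_, σ⁻¹.1 (k.castSucc, -1)) at hk
      rw [height_mk, hneg, value_antipode] at hk hne
      omega
    have hmono : StrictMono fun k => value (σ⁻¹.1 (k, 1)) := Fin.strictMono_iff_lt_succ.2 hstep
    refine inv_eq_one.1 (eq_one_of_strictMono (fun k => ?_) hmono)
    exact hzero.trans_le (hmono.monotone (Fin.zero_le k))

theorem smul_inversions_inv_mul (σ τ : hyperoctahedral n) :
    σ • inversions (σ⁻¹ * τ) = inversions σ ∆ inversions τ := by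
  have h := inversions_mul σ (σ⁻¹ * τ)
  rw [mul_inv_cancel_left] at h
  rw [h, symmDiff_symmDiff_cancel_left]

theorem inversions_injective : Function.Injective (inversions (n := n)) := by
  intro σ τ h
  have hempty : inversions (σ⁻¹ * τ) = ∅ := by
    rw [← Finset.smul_finset_eq_empty (a := σ), smul_inversions_inv_mul, h, symmDiff_self]
    rfl
  refine inv_mul_eq_one.1 (eq_one_of_simpleRoot_notMem fun i => ?_)
  rw [hempty]
  exact Finset.notMem_empty _

theorem gen_smul_simpleRoot (i : Fin n) : gen i • simpleRoot i = simpleRoot i := by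
  have h := inversions_mul (gen i) (gen i)
  rw [gen_mul_self, inversions_one, inversions_gen, Finset.smul_finset_singleton, eq_comm,
    ← Finset.bot_eq_empty, symmDiff_eq_bot] at h
  exact (Finset.singleton_injective h).symm

theorem simpleRoot_mem_gen_smul {i : Fin n} {S : Finset (PosRoot n)} :
    simpleRoot i ∈ gen i • S ↔ simpleRoot i ∈ S := by
  conv_lhs => rw [← gen_smul_simpleRoot i, Finset.smul_mem_smul_finset_iff]

theorem inversions_gen_mul {i : Fin n} {σ : hyperoctahedral n}
    (h : simpleRoot i ∉ inversions σ) :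
    inversions (gen i * σ) =
      Finset.cons (simpleRoot i) (gen i • inversions σ) (simpleRoot_mem_gen_smul.not.2 h) := by
  rw [inversions_mul, inversions_gen, Finset.cons_eq_insert, Finset.insert_eq,
    ← Finset.sup_eq_union]
  exact (Finset.disjoint_singleton_left.2 (simpleRoot_mem_gen_smul.not.2 h)).symmDiff_eq_sup

theorem simpleRoot_mem_inversions_gen_mul {i : Fin n} {σ : hyperoctahedral n} :
    simpleRoot i ∈ inversions (gen i * σ) ↔ simpleRoot i ∉ inversions σ := by
  rw [inversions_mul, inversions_gen, Finset.mem_symmDiff, simpleRoot_mem_gen_smul,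
    Finset.mem_singleton]
  tauto

theorem card_inversions_gen_mul {i : Fin n} {σ : hyperoctahedral n}
    (h : simpleRoot i ∉ inversions σ) :
    (inversions (gen i * σ)).card = (inversions σ).card + 1 := by
  rw [inversions_gen_mul h, Finset.card_cons, Finset.card_smul_finset]

theorem induction_on_ascents {motive : hyperoctahedral n → Prop} (one : motive 1)
    (gen_mul : ∀ i σ, simpleRoot i ∉ inversions σ → motive σ → motive (gen i * σ))
    (σ : hyperoctahedral n) : motive σ := by
  induction h : (inversions σ).card generalizing σ with
  | zero =>
    rw [eq_one_of_simpleRoot_notMem (σ := σ) fun i => by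
      rw [Finset.card_eq_zero.1 h]
      exact Finset.notMem_empty _]
    exact one
  | succ m ih =>
    obtain ⟨i, hi⟩ : ∃ i, simpleRoot i ∈ inversions σ := by
      by_contra! hσ
      rw [eq_one_of_simpleRoot_notMem hσ, inversions_one] at h
      exact absurd h (Nat.succ_ne_zero m).symm
    have hσ : gen i * (gen i * σ) = σ := by rw [← mul_assoc, gen_mul_self, one_mul]
    have hasc : simpleRoot i ∉ inversions (gen i * σ) := by
      rwa [← simpleRoot_mem_inversions_gen_mul, hσ]
    have hcard := card_inversions_gen_mul hasc
    rw [hσ] at hcard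
    rw [← hσ]
    exact gen_mul i _ hasc (ih _ (by omega))

section Weight

variable {M : Type*} (α q : M)

/-- The weight of a positive root: `α` for the long roots `2 e_p` and `q` for the short ones. -/
def rootWeight (r : PosRoot n) : M := if r.1.IsDiag then α else q

theorem rootWeight_simpleRoot (i : Fin n) :
    rootWeight α q (simpleRoot i) = if i.val = 0 then α else q := by
  have hdiag : (simpleRoot i).1.IsDiag ↔ i.val = 0 := by
    by_cases hi : i.val = 0
    · simp only [coe_simpleRoot_of_eq_zero hi, Sym2.mk_isDiag_iff, hi]
    · simp only [coe_simpleRoot_of_ne_zero hi, Sym2.mk_isDiag_iff, hi, Prod.mk.injEq,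
        show (1 : ℤˣ) ≠ -1 by decide, and_false]
  simp only [rootWeight, hdiag]

theorem rootWeight_smul (σ : hyperoctahedral n) (r : PosRoot n) :
    rootWeight α q (σ • r) = rootWeight α q r := by
  have hdiag : (σ • r).1.IsDiag ↔ r.1.IsDiag := by
    rcases absRoot_eq_or (r.1.map σ.1) with h | h <;> rw [coe_smul, h]
    · rw [Sym2.isDiag_map σ.1.injective]
    · rw [Sym2.isDiag_map (Function.Involutive.injective antipode_antipode),
        Sym2.isDiag_map σ.1.injective]
  simp only [rootWeight, hdiag]

variable [CommMonoid M]

/-- The weight `α ^ l₁(σ) * q ^ l₂(σ)` of a signed permutation, as a product over inversions. -/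
def weight (σ : hyperoctahedral n) : M := ∏ r ∈ inversions σ, rootWeight α q r

theorem weight_one : weight α q (1 : hyperoctahedral n) = 1 := by
  rw [weight, inversions_one, Finset.prod_empty]

theorem prod_smul_rootWeight (σ : hyperoctahedral n) (S : Finset (PosRoot n)) :
    ∏ r ∈ σ • S, rootWeight α q r = ∏ r ∈ S, rootWeight α q r := by
  rw [Finset.smul_finset_def, Finset.prod_image (MulAction.injective σ).injOn]
  exact Finset.prod_congr rfl fun r _ => rootWeight_smul α q σ r

theorem weight_inv_mul (σ τ : hyperoctahedral n) :
    weight α q (σ⁻¹ * τ) = ∏ r ∈ inversions σ ∆ inversions τ, rootWeight α q r := by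
  rw [← smul_inversions_inv_mul, prod_smul_rootWeight, weight]

theorem weight_gen_mul {i : Fin n} {σ : hyperoctahedral n}
    (h : simpleRoot i ∉ inversions σ) :
    weight α q (gen i * σ) = rootWeight α q (simpleRoot i) * weight α q σ := by
  rw [weight, inversions_gen_mul h, Finset.prod_cons, prod_smul_rootWeight, weight]

theorem weight_mul_gen {i : Fin n} {σ : hyperoctahedral n}
    (h : 0 < height ((simpleRoot i).1.map σ.1)) :
    weight α q (σ * gen i) = weight α q σ * rootWeight α q (simpleRoot i) := by
  have hnot : σ • simpleRoot i ∉ inversions σ := by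
    rw [mem_inversions, coe_smul, absRoot, if_neg h.not_gt, ← Root.map_mul, inv_mul_cancel,
      Root.map_one, not_lt]
    exact (simpleRoot i).2.le
  rw [weight, inversions_mul, inversions_gen, Finset.smul_finset_singleton,
    (Finset.disjoint_singleton_right.2 hnot).symmDiff_eq_sup, Finset.sup_eq_union,
    Finset.prod_union (Finset.disjoint_singleton_right.2 hnot), Finset.prod_singleton,
    rootWeight_smul, weight]

theorem card_inversions_gen_mul_le (i : Fin n) (σ : hyperoctahedral n) :
    (inversions (gen i * σ)).card ≤ (inversions σ).card + 1 := by
  rw [inversions_mul, inversions_gen, ← Finset.card_smul_finset (gen i) (inversions σ), add_comm,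
    ← Finset.card_singleton (simpleRoot i)]
  exact (Finset.card_le_card Finset.symmDiff_subset_union).trans (Finset.card_union_le _ _)

theorem card_inversions_prod_le (w : List (Fin n)) :
    (inversions (w.map gen).prod).card ≤ w.length := by
  induction w with
  | nil =>
    rw [List.map_nil, List.prod_nil, inversions_one, Finset.card_empty]
    exact Nat.zero_le _
  | cons i w ih =>
    rw [List.map_cons, List.prod_cons, List.length_cons]
    exact (card_inversions_gen_mul_le i _).trans (Nat.succ_le_succ ih)

theorem weight_prod_of_card_eq_length {w : List (Fin n)}
    (hw : (inversions (w.map gen).prod).card = w.length) :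
    weight α q (w.map gen).prod = (w.map fun i => rootWeight α q (simpleRoot i)).prod := by
  induction w with
  | nil => exact weight_one α q
  | cons i w ih =>
    rw [List.map_cons, List.prod_cons, List.length_cons] at hw
    have hle := card_inversions_prod_le w
    have hasc : simpleRoot i ∉ inversions (w.map gen).prod := by
      intro hmem
      have hcard :=
        card_inversions_gen_mul (simpleRoot_mem_inversions_gen_mul.not.2 (not_not.2 hmem))
      rw [← mul_assoc, gen_mul_self, one_mul] at hcard
      omega
    have hlen := card_inversions_gen_mul hasc
    rw [List.map_cons, List.map_cons, List.prod_cons, List.prod_cons, weight_gen_mul α q hasc,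
      ih (by omega)]

theorem exists_word_length_eq_card_inversions (σ : hyperoctahedral n) :
    ∃ w : List (Fin n), (w.map gen).prod = σ ∧ w.length = (inversions σ).card := by
  induction σ using induction_on_ascents with
  | one => exact ⟨[], rfl, by rw [inversions_one]; rfl⟩
  | gen_mul i σ h ih =>
    obtain ⟨w, rfl, hw⟩ := ih
    exact ⟨i :: w, rfl, by rw [card_inversions_gen_mul h, ← hw, List.length_cons]⟩

theorem IsReducedWord.length_eq {σ : hyperoctahedral n} {w : List (Fin n)}
    (hw : IsReducedWord σ w) : w.length = (inversions σ).card := by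
  obtain ⟨w', hw', hlen⟩ := exists_word_length_eq_card_inversions σ
  refine le_antisymm (hlen ▸ hw.2 w' hw') ?_
  rw [← hw.1]
  exact card_inversions_prod_le w

theorem prod_rootWeight_simpleRoot (w : List (Fin n)) :
    (w.map fun i => rootWeight α q (simpleRoot i)).prod =
      α ^ (w.countP fun i => i.val = 0) * q ^ (w.countP fun i => i.val ≠ 0) := by
  induction w with
  | nil => simp
  | cons i w ih =>
    rw [List.map_cons, List.prod_cons, ih, List.countP_cons, List.countP_cons,
      rootWeight_simpleRoot]
    by_cases hi : i.val = 0
    · simp [hi, pow_succ', mul_assoc]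
    · simp [hi, pow_succ', mul_left_comm]

theorem pow_lOne_mul_pow_lTwo (σ : hyperoctahedral n) :
    α ^ lOne σ * q ^ lTwo σ = weight α q σ := by
  have hred : IsReducedWord σ (reducedWord σ) := (exists_reducedWord σ).choose_spec
  have hcard : (inversions ((reducedWord σ).map gen).prod).card = (reducedWord σ).length := by
    rw [hred.1, hred.length_eq]
  rw [lOne, lTwo, ← prod_rootWeight_simpleRoot, ← weight_prod_of_card_eq_length α q hcard, hred.1]

end Weight

/-! ## Coset representatives -/

/-- The element of `Σ(n)` with prescribed values at the positive points. -/
noncomputable def ofInjective (f : Fin n → SignedPoint n)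
    (hf : Function.Injective (Prod.fst ∘ f)) : hyperoctahedral n :=
  ⟨Equiv.ofBijective (fun p : SignedPoint n => ((f p.1).1, p.2 * (f p.1).2)) (by
      rw [← Finite.injective_iff_bijective]
      rintro ⟨i, ε⟩ ⟨j, δ⟩ h
      obtain ⟨hfst, hsnd⟩ := Prod.mk.inj h
      obtain rfl : i = j := hf hfst
      exact Prod.ext rfl (mul_right_cancel hsnd)), fun k ε => Prod.ext rfl (neg_mul ε (f k).2)⟩

theorem ofInjective_apply (f : Fin n → SignedPoint n)
    (hf : Function.Injective (Prod.fst ∘ f)) (k : Fin n) (ε : ℤˣ) :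
    (ofInjective f hf).1 (k, ε) = ((f k).1, ε * (f k).2) := rfl

theorem fst_comp_snoc_injective {f : Fin n → SignedPoint (n + 1)} {p : SignedPoint (n + 1)}
    (hf : Function.Injective (Prod.fst ∘ f)) (hp : ∀ k, (f k).1 ≠ p.1) :
    Function.Injective (Prod.fst ∘ (Fin.snoc f p : Fin (n + 1) → SignedPoint (n + 1))) := by
  rw [Fin.comp_snoc]
  exact Fin.snoc_injective_of_injective hf fun ⟨k, hk⟩ => hp k hk

/-- The value at `τ` of the inclusion `extend` of `Σ(n)` in `Σ(n + 1)`. -/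
noncomputable def extendFun (τ : hyperoctahedral n) : hyperoctahedral (n + 1) :=
  ofInjective (Fin.snoc (fun k => Prod.map Fin.castSucc id (τ.1 (k, 1))) (Fin.last n, 1))
    (fst_comp_snoc_injective ((Fin.castSucc_injective n).comp (absPerm τ).injective)
      fun _ => Fin.castSucc_ne_last _)

theorem extendFun_castSucc (τ : hyperoctahedral n) (k : Fin n) (ε : ℤˣ) :
    (extendFun τ).1 (k.castSucc, ε) = Prod.map Fin.castSucc id (τ.1 (k, ε)) := by
  rw [extendFun, ofInjective_apply, Fin.snoc_castSucc, apply_eq τ k ε]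
  rfl

theorem extendFun_last (τ : hyperoctahedral n) (ε : ℤˣ) :
    (extendFun τ).1 (Fin.last n, ε) = (Fin.last n, ε) := by
  rw [extendFun, ofInjective_apply, Fin.snoc_last, mul_one]

theorem hyperoctahedral_ext_snoc {σ τ : hyperoctahedral (n + 1)}
    (hcast : ∀ k : Fin n, σ.1 (k.castSucc, 1) = τ.1 (k.castSucc, 1))
    (hlast : σ.1 (Fin.last n, 1) = τ.1 (Fin.last n, 1)) : σ = τ :=
  hyperoctahedral_ext fun k => Fin.lastCases hlast hcast k

/-- The inclusion of `Σ(n)` in `Σ(n + 1)` as the stabilizer of the last point. -/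
noncomputable def extend : hyperoctahedral n →* hyperoctahedral (n + 1) where
  toFun := extendFun
  map_one' := hyperoctahedral_ext_snoc (fun k => extendFun_castSucc 1 k 1) (extendFun_last 1 1)
  map_mul' σ τ := by
    refine hyperoctahedral_ext_snoc (fun k => ?_) ?_
    · rw [mul_apply, extendFun_castSucc, extendFun_castSucc, mul_apply]
      exact (extendFun_castSucc σ _ _).symm
    · rw [mul_apply, extendFun_last, extendFun_last, extendFun_last]

theorem extend_castSucc (τ : hyperoctahedral n) (k : Fin n) (ε : ℤˣ) :
    (extend τ).1 (k.castSucc, ε) = Prod.map Fin.castSucc id (τ.1 (k, ε)) :=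
  extendFun_castSucc τ k ε

theorem extend_last (τ : hyperoctahedral n) (ε : ℤˣ) :
    (extend τ).1 (Fin.last n, ε) = (Fin.last n, ε) :=
  extendFun_last τ ε

theorem extend_injective : Function.Injective (extend (n := n)) := by
  intro σ τ h
  refine hyperoctahedral_ext fun k =>
    (Fin.castSucc_injective n).prodMap Function.injective_id ?_
  rw [← extend_castSucc, ← extend_castSucc, h]

theorem exists_extend_eq {ρ : hyperoctahedral (n + 1)}
    (h : ρ.1 (Fin.last n, 1) = (Fin.last n, 1)) : ∃ τ, extend τ = ρ := by
  have hne (k : Fin n) : (ρ.1 (k.castSucc, 1)).1 ≠ Fin.last n := by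
    have habs : absPerm ρ (Fin.last n) = Fin.last n := congrArg Prod.fst h
    intro hk
    exact Fin.castSucc_ne_last k ((absPerm ρ).injective (hk.trans habs.symm))
  have hinj : Function.Injective (Prod.fst ∘ fun k : Fin n =>
      (((ρ.1 (k.castSucc, 1)).1.castPred (hne k), (ρ.1 (k.castSucc, 1)).2) : SignedPoint n)) :=
    fun i j hij => Fin.castSucc_injective n
      ((absPerm ρ).injective (Fin.castPred_inj (hi := hne i) (hj := hne j) |>.1 hij))
  refine ⟨ofInjective _ hinj, hyperoctahedral_ext_snoc (fun k => ?_) ?_⟩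
  · rw [extend_castSucc, ofInjective_apply, one_mul, Prod.map_apply, Fin.castSucc_castPred, id]
  · rw [extend_last, h]

/-- The element of `Σ(n + 1)` that maps `ε (k + 1)` to the last point, and maps the remaining
positive points increasingly to `1, …, n`. -/
noncomputable def cosetRep (k : Fin (n + 1)) (ε : ℤˣ) : hyperoctahedral (n + 1) :=
  (ofInjective (Fin.snoc (fun i => (k.succAbove i, 1)) (k, ε))
    (fst_comp_snoc_injective (Fin.succAbove_right_injective (p := k)) (Fin.succAbove_ne k)))⁻¹

theorem cosetRep_inv_castSucc (k : Fin (n + 1)) (ε : ℤˣ) (i : Fin n) (δ : ℤˣ) :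
    (cosetRep k ε)⁻¹.1 (i.castSucc, δ) = (k.succAbove i, δ) := by
  rw [cosetRep, inv_inv, ofInjective_apply, Fin.snoc_castSucc, mul_one]

theorem cosetRep_inv_last (k : Fin (n + 1)) (ε δ : ℤˣ) :
    (cosetRep k ε)⁻¹.1 (Fin.last n, δ) = (k, δ * ε) := by
  rw [cosetRep, inv_inv, ofInjective_apply, Fin.snoc_last]

theorem extend_mul_cosetRep_inv_last (τ : hyperoctahedral n) (k : Fin (n + 1)) (ε : ℤˣ) :
    (extend τ * cosetRep k ε)⁻¹.1 (Fin.last n, 1) = (k, ε) := by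
  rw [mul_inv_rev, mul_apply, ← map_inv, extend_last, cosetRep_inv_last, one_mul]

theorem extend_mul_cosetRep_bijective :
    Function.Bijective fun t : hyperoctahedral n × Fin (n + 1) × ℤˣ =>
      extend t.1 * cosetRep t.2.1 t.2.2 := by
  constructor
  · rintro ⟨σ, k, ε⟩ ⟨τ, l, δ⟩ (h : extend σ * cosetRep k ε = extend τ * cosetRep l δ)
    have hlast : (k, ε) = (l, δ) := by
      rw [← extend_mul_cosetRep_inv_last σ, h, extend_mul_cosetRep_inv_last]
    obtain ⟨rfl, rfl⟩ := Prod.mk.inj hlast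
    exact Prod.ext (extend_injective (mul_right_cancel h)) rfl
  · intro σ
    obtain ⟨k, ε, hp⟩ : ∃ k ε, σ⁻¹.1 (Fin.last n, 1) = (k, ε) := ⟨_, _, rfl⟩
    obtain ⟨τ, hτ⟩ : ∃ τ, extend τ = σ * (cosetRep k ε)⁻¹ := by
      refine exists_extend_eq ?_
      rw [mul_apply, cosetRep_inv_last, one_mul, ← hp]
      exact σ.1.apply_symm_apply _
    exact ⟨(τ, k, ε), mul_eq_of_eq_mul_inv hτ⟩

theorem extend_gen (i : Fin n) : extend (gen i) = gen i.castSucc := by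
  refine hyperoctahedral_ext_snoc (fun j => value_injective ?_) (value_injective ?_)
  · rw [extend_castSucc]
    by_cases hi : i.val = 0
    · rw [value_gen_of_eq_zero (i := i.castSucc) hi]
      exact value_gen_of_eq_zero hi (j, 1)
    · rw [value_gen_of_ne_zero (i := i.castSucc) hi]
      exact value_gen_of_ne_zero hi (j, 1)
  · rw [extend_last]
    by_cases hi : i.val = 0
    · rw [value_gen_of_eq_zero (i := i.castSucc) hi]
      simp only [value_one, Fin.val_last]
      grind
    · rw [value_gen_of_ne_zero (i := i.castSucc) hi]
      simp only [value_one, Fin.val_last, Fin.val_castSucc]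
      grind

theorem cosetRep_eq_mul_gen {k l : Fin (n + 1)} {ε δ : ℤˣ} (i : Fin (n + 1))
    (hsuccAbove : ∀ j, (gen i).1 (k.succAbove j, 1) = (l.succAbove j, 1))
    (hlast : (gen i).1 (k, ε) = (l, δ)) : cosetRep l δ = cosetRep k ε * gen i := by
  refine inv_injective (hyperoctahedral_ext_snoc (fun j => ?_) ?_)
  · rw [mul_inv_rev, gen_inv, mul_apply, cosetRep_inv_castSucc, cosetRep_inv_castSucc, hsuccAbove]
  · rw [mul_inv_rev, gen_inv, mul_apply, cosetRep_inv_last, cosetRep_inv_last, one_mul, one_mul,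
      hlast]

theorem val_succAbove (k : Fin (n + 1)) (i : Fin n) :
    (k.succAbove i).val = if i.val < k.val then i.val else i.val + 1 := by
  simp only [Fin.succAbove, Fin.lt_def, Fin.val_castSucc, apply_ite Fin.val, Fin.val_succ]

theorem cosetRep_castSucc_one (k : Fin n) :
    cosetRep k.castSucc 1 = cosetRep k.succ 1 * gen k.succ := by
  refine cosetRep_eq_mul_gen _ (fun j => value_injective ?_) (value_injective ?_) <;>
    rw [value_gen_of_ne_zero (Nat.succ_ne_zero k)] <;>
    simp only [value_one, val_succAbove, Fin.val_succ, Fin.val_castSucc] <;> grind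

theorem cosetRep_zero_neg_one :
    cosetRep (0 : Fin (n + 1)) (-1) = cosetRep 0 1 * gen 0 := by
  refine cosetRep_eq_mul_gen _ (fun j => value_injective ?_) (value_injective ?_) <;>
    rw [value_gen_of_eq_zero (Fin.val_zero _)] <;>
    simp only [value_one, value_neg_one, val_succAbove, Fin.val_zero] <;> grind

theorem cosetRep_succ_neg_one (k : Fin n) :
    cosetRep k.succ (-1) = cosetRep k.castSucc (-1) * gen k.succ := by
  refine cosetRep_eq_mul_gen _ (fun j => value_injective ?_) (value_injective ?_) <;>
    rw [value_gen_of_ne_zero (Nat.succ_ne_zero k)] <;>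
    simp only [value_one, value_neg_one, val_succAbove, Fin.val_succ, Fin.val_castSucc] <;> grind

theorem cosetRep_last_one : cosetRep (Fin.last n) 1 = 1 := by
  refine inv_injective (hyperoctahedral_ext_snoc (fun j => ?_) ?_)
  · rw [cosetRep_inv_castSucc, Fin.succAbove_last, inv_one]
    rfl
  · rw [cosetRep_inv_last, one_mul, inv_one]
    rfl

theorem height_map_pos_of_apply_eq_last {σ : hyperoctahedral (n + 1)}
    {p : SignedPoint (n + 1)} (hp : σ.1 p = (Fin.last n, 1)) {r : Root (n + 1)}
    (hr : height r ≠ 0) (hpr : p ∈ r) : 0 < height (r.map σ.1) := by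
  obtain ⟨q, rfl⟩ := hpr
  have hne := (height_map_eq_zero_iff σ _).not.2 hr
  rw [Sym2.map_mk, height_mk, hp, value_one, Fin.val_last] at hne ⊢
  have hq := neg_le_value (σ.1 q)
  omega

section Weight

variable {M : Type*} [CommMonoid M] (α q : M)

theorem weight_mul_gen_of_apply_eq_last {σ : hyperoctahedral (n + 1)}
    {p : SignedPoint (n + 1)} (hp : σ.1 p = (Fin.last n, 1)) {i : Fin (n + 1)}
    (hpi : p ∈ (simpleRoot i).1) :
    weight α q (σ * gen i) = weight α q σ * if i.val = 0 then α else q := by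
  rw [← rootWeight_simpleRoot]
  exact weight_mul_gen α q (height_map_pos_of_apply_eq_last hp (simpleRoot i).2.ne' hpi)

theorem simpleRoot_castSucc_mem_inversions_extend {i : Fin n} {τ : hyperoctahedral n} :
    simpleRoot i.castSucc ∈ inversions (extend τ) ↔ simpleRoot i ∈ inversions τ := by
  rw [mem_inversions, mem_inversions, ← map_inv]
  by_cases hi : i.val = 0
  · rw [coe_simpleRoot_of_eq_zero hi, coe_simpleRoot_of_eq_zero (i := i.castSucc) hi, Sym2.map_mk,
      extend_castSucc]
    rfl
  · rw [coe_simpleRoot_of_ne_zero hi, coe_simpleRoot_of_ne_zero (i := i.castSucc) hi, Sym2.map_mk,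
      extend_castSucc, height_mk]
    exact iff_of_eq (congrArg (fun p => value (τ⁻¹.1 (i, 1)) + value p < 0)
      (extend_castSucc τ⁻¹ ⟨i.val - 1, _⟩ (-1)))

theorem weight_extend (τ : hyperoctahedral n) : weight α q (extend τ) = weight α q τ := by
  induction τ using induction_on_ascents with
  | one => rw [map_one, weight_one, weight_one]
  | gen_mul i τ h ih =>
    rw [map_mul, extend_gen, weight_gen_mul α q h, ← ih, rootWeight_simpleRoot,
      weight_gen_mul α q (simpleRoot_castSucc_mem_inversions_extend.not.2 h),
      rootWeight_simpleRoot, Fin.val_castSucc]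

theorem extend_mul_cosetRep_apply (τ : hyperoctahedral n) (k : Fin (n + 1)) (ε : ℤˣ) :
    (extend τ * cosetRep k ε).1 (k, ε) = (Fin.last n, 1) := by
  rw [← extend_mul_cosetRep_inv_last τ]
  exact Equiv.apply_symm_apply _ _

theorem weight_extend_mul_cosetRep_one (τ : hyperoctahedral n) (k : Fin (n + 1)) :
    weight α q (extend τ * cosetRep k 1) = weight α q τ * q ^ (n - k.val) := by
  induction k using Fin.reverseInduction with
  | last => rw [cosetRep_last_one, mul_one, weight_extend, Fin.val_last, Nat.sub_self, pow_zero,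
      mul_one]
  | cast k ih =>
    have hmem : (k.succ, 1) ∈ (simpleRoot k.succ).1 := by
      rw [coe_simpleRoot_of_ne_zero (Nat.succ_ne_zero k)]
      exact Sym2.mem_mk_left _ _
    rw [cosetRep_castSucc_one, ← mul_assoc,
      weight_mul_gen_of_apply_eq_last α q (extend_mul_cosetRep_apply τ _ _) hmem, ih,
      Fin.val_succ, if_neg (Nat.succ_ne_zero k), mul_assoc, ← pow_succ, Fin.val_castSucc]
    congr 2
    omega

theorem weight_extend_mul_cosetRep_neg_one (τ : hyperoctahedral n) (k : Fin (n + 1)) :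
    weight α q (extend τ * cosetRep k (-1)) = weight α q τ * (α * q ^ (n + k.val)) := by
  induction k using Fin.induction with
  | zero =>
    have hmem : (0, 1) ∈ (simpleRoot (0 : Fin (n + 1))).1 := by
      rw [coe_simpleRoot_of_eq_zero rfl]
      exact Sym2.mem_mk_left _ _
    rw [cosetRep_zero_neg_one, ← mul_assoc,
      weight_mul_gen_of_apply_eq_last α q (extend_mul_cosetRep_apply τ _ _) hmem,
      weight_extend_mul_cosetRep_one, if_pos (Fin.val_zero _), Fin.val_zero, Nat.sub_zero, add_zero,
      mul_assoc, mul_comm α]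
  | succ k ih =>
    have hmem : (k.castSucc, -1) ∈ (simpleRoot k.succ).1 := by
      rw [coe_simpleRoot_of_ne_zero (Nat.succ_ne_zero k)]
      exact Sym2.mem_mk_right _ _
    rw [cosetRep_succ_neg_one, ← mul_assoc,
      weight_mul_gen_of_apply_eq_last α q (extend_mul_cosetRep_apply τ _ _) hmem, ih,
      Fin.val_succ, if_neg (Nat.succ_ne_zero k), Fin.val_castSucc, ← add_assoc, pow_succ]
    simp only [mul_assoc]

end Weight

end SignedPermutations

/-! ## Positive definiteness and nondegeneracy -/

section Walsh

variable {ι : Type*} [DecidableEq ι]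

/-- The Walsh character `(-1) ^ |S ∩ T|` of the group of finite subsets of `ι`. -/
def walsh (S T : Finset ι) : ℝ := (-1) ^ (S ∩ T).card

theorem walsh_comm (S T : Finset ι) : walsh S T = walsh T S := by
  rw [walsh, walsh, Finset.inter_comm]

theorem walsh_eq_prod (S T : Finset ι) : walsh S T = ∏ i ∈ S, if i ∈ T then -1 else 1 := by
  rw [Finset.prod_ite_mem, Finset.prod_const, walsh]

theorem walsh_mul_walsh (A S T : Finset ι) : walsh A S * walsh A T = walsh A (S ∆ T) := by
  simp only [walsh_eq_prod, ← Finset.prod_mul_distrib]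
  refine Finset.prod_congr rfl fun i _ => ?_
  by_cases hS : i ∈ S <;> by_cases hT : i ∈ T <;> simp [hS, hT, Finset.mem_symmDiff]

variable [Fintype ι]

theorem sum_walsh (S : Finset ι) :
    ∑ A, walsh A S = if S = ∅ then 2 ^ Fintype.card ι else 0 := by
  simp only [walsh_eq_prod, ← Finset.powerset_univ, ← Finset.prod_one_add]
  split_ifs with hS
  · simp [hS, one_add_one_eq_two]
  · obtain ⟨i, hi⟩ := Finset.nonempty_iff_ne_empty.2 hS
    exact Finset.prod_eq_zero (Finset.mem_univ i) (by rw [if_pos hi, add_neg_cancel])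

theorem walsh_mul_self :
    Matrix.of walsh * Matrix.of walsh = (2 ^ Fintype.card ι : ℝ) • (1 : Matrix (Finset ι) _ ℝ) := by
  ext S T
  simp only [Matrix.mul_apply, Matrix.of_apply, walsh_comm S, walsh_mul_walsh, sum_walsh,
    Matrix.smul_apply, Matrix.one_apply, smul_eq_mul, mul_ite, mul_one, mul_zero,
    ← Finset.bot_eq_empty, symmDiff_eq_bot]

theorem walsh_mulVec_injective : Function.Injective (Matrix.of (walsh (ι := ι))).mulVec := by
  refine Function.Injective.of_comp (f := (Matrix.of walsh).mulVec) fun v w h => ?_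
  simp only [Function.comp_apply, Matrix.mulVec_mulVec, walsh_mul_self, Matrix.smul_mulVec,
    Matrix.one_mulVec] at h
  exact smul_right_injective _ (pow_ne_zero _ two_ne_zero) h

/-- The mass at `A` of the product measure on the subsets of `ι` whose Walsh transform is
`S ↦ ∏ i ∈ S, c i`. -/
noncomputable def walshMass (c : ι → ℝ) (A : Finset ι) : ℝ :=
  (∏ i ∈ A, (1 - c i) / 2) * ∏ i ∈ Finset.univ \ A, (1 + c i) / 2

theorem walshMass_pos {c : ι → ℝ} (hc : ∀ i, |c i| < 1) (A : Finset ι) : 0 < walshMass c A :=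
  mul_pos (Finset.prod_pos fun i _ => by linarith [(abs_lt.1 (hc i)).2])
    (Finset.prod_pos fun i _ => by linarith [(abs_lt.1 (hc i)).1])

theorem sum_walshMass_mul_walsh (c : ι → ℝ) (S : Finset ι) :
    ∑ A, walshMass c A * walsh A S = ∏ i ∈ S, c i := by
  calc ∑ A, walshMass c A * walsh A S
      = ∑ A ∈ Finset.univ.powerset, (∏ i ∈ A, (1 - c i) / 2 * if i ∈ S then -1 else 1) *
          ∏ i ∈ Finset.univ \ A, (1 + c i) / 2 := by
        rw [Finset.powerset_univ]
        refine Finset.sum_congr rfl fun A _ => ?_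
        rw [walshMass, walsh_eq_prod, Finset.prod_mul_distrib, mul_right_comm]
    _ = ∏ i, ((1 - c i) / 2 * (if i ∈ S then -1 else 1) + (1 + c i) / 2) :=
        (Finset.prod_add _ _ _).symm
    _ = ∏ i, if i ∈ S then c i else 1 := by
        refine Finset.prod_congr rfl fun i _ => ?_
        split_ifs <;> ring
    _ = ∏ i ∈ S, c i := by rw [Finset.prod_ite_mem, Finset.univ_inter]

end Walsh

theorem posDef_prod_symmDiff {ι : Type*} [DecidableEq ι] [Finite ι] {c : ι → ℝ}
    (hc : ∀ i, |c i| < 1) :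
    (Matrix.of fun S T : Finset ι => ∏ i ∈ S ∆ T, c i).PosDef := by
  cases nonempty_fintype ι
  have hfactor : (Matrix.of fun S T : Finset ι => ∏ i ∈ S ∆ T, c i) =
      (Matrix.of walsh).conjTranspose * Matrix.diagonal (walshMass c) * Matrix.of walsh := by
    ext S T
    rw [Matrix.mul_apply, Matrix.of_apply, ← sum_walshMass_mul_walsh]
    refine Finset.sum_congr rfl fun A _ => ?_
    rw [Matrix.mul_diagonal, Matrix.conjTranspose_apply, Matrix.of_apply, Matrix.of_apply,
      star_trivial, ← walsh_mul_walsh]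
    ring
  rw [hfactor]
  exact (Matrix.PosDef.diagonal (walshMass_pos hc)).conjTranspose_mul_mul_same
    walsh_mulVec_injective


theorem posDef_weight {α q : ℝ} (hα : |α| < 1) (hq : |q| < 1) (n : ℕ) :
    (Matrix.of fun σ τ : hyperoctahedral n => weight α q (σ⁻¹ * τ)).PosDef := by
  have hroot (r : PosRoot n) : |rootWeight α q r| < 1 := by
    rw [rootWeight]
    split_ifs
    exacts [hα, hq]
  simp only [weight_inv_mul]
  exact (posDef_prod_symmDiff hroot).submatrix inversions_injective

theorem injective_sum_smul_of_isUnit {k G V : Type*} [CommRing k] [Group G] [Fintype G]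
    [DecidableEq G] [AddCommGroup V] [Module k V] (ρ : Representation k G V) {φ : G → k}
    (hφ : IsUnit (Matrix.of fun σ τ => φ (σ⁻¹ * τ))) :
    Function.Injective ⇑(∑ σ, φ σ • ρ σ : V →ₗ[k] V) := by
  refine (injective_iff_map_eq_zero _).2 fun v hv => ?_
  have hrow (σ : G) : ∑ τ, φ (σ⁻¹ * τ) • ρ τ v = 0 := by
    rw [← LinearMap.map_zero (ρ σ), ← hv, LinearMap.sum_apply, map_sum,
      ← Equiv.sum_comp (Equiv.mulLeft σ)]
    refine Finset.sum_congr rfl fun τ _ => ?_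
    rw [Equiv.coe_mulLeft, inv_mul_cancel_left, map_mul, LinearMap.smul_apply, map_smul,
      Module.End.mul_apply]
  obtain ⟨N, hN⟩ := hφ.exists_left_inv
  calc v = ∑ τ, (1 : Matrix G G k) 1 τ • ρ τ v := by simp [Matrix.one_apply]
    _ = ∑ σ, N 1 σ • ∑ τ, φ (σ⁻¹ * τ) • ρ τ v := by
        simp only [← hN, Matrix.mul_apply, Matrix.of_apply, Finset.sum_smul, Finset.smul_sum,
          mul_smul]
        exact Finset.sum_comm
    _ = 0 := by simp only [hrow, smul_zero, Finset.sum_const_zero]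

section Fock

variable {H : Type*} [NormedAddCommGroup H] [InnerProductSpace ℂ H]

theorem symmetrizer_eq (J : H →ₗ[ℂ] H) (α q : ℝ) (n : ℕ) :
    symmetrizer J α q n = ∑ σ : hyperoctahedral n, ((weight α q σ : ℝ) : ℂ) • act J σ := by
  simp only [symmetrizer, pow_lOne_mul_pow_lTwo]

theorem symmetrizer_injective {J : H →ₗ[ℂ] H} (hJ : Function.Involutive J) {α q : ℝ}
    (hα : |α| < 1) (hq : |q| < 1) (n : ℕ) : Function.Injective (symmetrizer J α q n) := by
  classical
  let ρ : Representation ℂ (hyperoctahedral n) (⨂[ℂ]^n H) :=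
    { toFun := act J, map_one' := act_one J, map_mul' := act_mul J hJ }
  rw [symmetrizer_eq]
  exact injective_sum_smul_of_isUnit ρ (φ := fun σ => ((weight α q σ : ℝ) : ℂ))
    ((posDef_weight hα hq n).isUnit.map Complex.ofRealHom.mapMatrix)

theorem exists_finiteDimensional_map_starProjection_eq {n : ℕ} (u : ⨂[ℂ]^n H) :
    ∃ S : Submodule ℂ H, FiniteDimensional ℂ S ∧ ∀ (T : Submodule ℂ H) [FiniteDimensional ℂ T],
      S ≤ T → PiTensorProduct.map (fun _ => T.starProjection.toLinearMap) u = u := by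
  induction u using PiTensorProduct.induction_on with
  | smul_tprod r v =>
    refine ⟨Submodule.span ℂ (Set.range v), FiniteDimensional.span_of_finite ℂ
      (Set.finite_range v), fun T _ hT => ?_⟩
    rw [map_smul, PiTensorProduct.map_tprod]
    congr 2
    funext i
    exact Submodule.starProjection_eq_self_iff.2 (hT (Submodule.subset_span ⟨i, rfl⟩))
  | add u v hu hv =>
    obtain ⟨S, hS, hSu⟩ := hu
    obtain ⟨S', hS', hSv⟩ := hv
    refine ⟨S ⊔ S', inferInstance, fun T _ hT => ?_⟩
    rw [map_add, hSu T (le_sup_left.trans hT), hSv T (le_sup_right.trans hT)]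

theorem map_starProjection_eq_sum {n : ℕ} {ι : Type*} [Fintype ι] {S : Submodule ℂ H}
    [S.HasOrthogonalProjection] (e : OrthonormalBasis ι ℂ S) :
    PiTensorProduct.map (fun _ : Fin n => S.starProjection.toLinearMap) =
      ∑ m : Fin n → ι, (innerFunctional fun i => (e (m i) : H)).smulRight
        (PiTensorProduct.tprod ℂ fun i => (e (m i) : H)) := by
  classical
  have hproj (x : H) : S.starProjection x = ∑ j, inner ℂ (e j : H) x • (e j : H) := by
    simp only [e.starProjection_eq_sum_rankOne, sum_apply,
      InnerProductSpace.rankOne_apply]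
  refine PiTensorProduct.ext (MultilinearMap.ext fun v => ?_)
  simp only [LinearMap.compMultilinearMap_apply, PiTensorProduct.map_tprod,
    ContinuousLinearMap.coe_coe, hproj, MultilinearMap.map_sum, MultilinearMap.map_smul_univ,
    LinearMap.sum_apply, LinearMap.smulRight_apply, innerFunctional_tprod]

theorem tensorInner_tprod_left {n : ℕ} (v : Fin n → H) :
    tensorInner n (PiTensorProduct.tprod ℂ v) = innerFunctional v := by
  refine PiTensorProduct.ext (MultilinearMap.ext fun y => ?_)
  simp only [LinearMap.compMultilinearMap_apply, tensorInner_tprod, innerFunctional_tprod]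

theorem eq_zero_of_tensorInner_eq_zero {n : ℕ} {u : ⨂[ℂ]^n H}
    (h : ∀ f, tensorInner n f u = 0) : u = 0 := by
  obtain ⟨S, hS, hu⟩ := exists_finiteDimensional_map_starProjection_eq u
  rw [← hu S le_rfl, map_starProjection_eq_sum (stdOrthonormalBasis ℂ S), LinearMap.sum_apply]
  refine Finset.sum_eq_zero fun m _ => ?_
  rw [LinearMap.smulRight_apply, ← tensorInner_tprod_left, h, zero_smul]

/-! ## The annihilation operator -/

theorem tensorInner_appendRight (x : H) {n : ℕ} (f : ⨂[ℂ]^n H) (u : ⨂[ℂ]^(n + 1) H) :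
    tensorInner (n + 1) (appendRight x n f) u = tensorInner n f (contract x (Fin.last n) u) := by
  induction f using PiTensorProduct.induction_on with
  | smul_tprod r v =>
    have htprod : tensorInner (n + 1) (appendRight x n (PiTensorProduct.tprod ℂ v)) =
        tensorInner n (PiTensorProduct.tprod ℂ v) ∘ₗ contract x (Fin.last n) := by
      refine PiTensorProduct.ext (MultilinearMap.ext fun (y : Fin (n + 1) → H) => ?_)
      simp only [LinearMap.compMultilinearMap_apply, LinearMap.comp_apply, appendRight_tprod,
        contract_tprod, map_smul, tensorInner_tprod, Fin.prod_univ_castSucc, Fin.snoc_castSucc,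
        Fin.snoc_last, Fin.succAbove_last_apply, smul_eq_mul]
      exact mul_comm _ _
    simp only [map_smul, map_smulₛₗ, LinearMap.smul_apply, htprod, LinearMap.comp_apply]
  | add f g hf hg => simp only [map_add, LinearMap.add_apply, hf, hg]

theorem signOp_one (J : H →ₗ[ℂ] H) : signOp J 1 = LinearMap.id := if_pos rfl

theorem signOp_neg_one (J : H →ₗ[ℂ] H) : signOp J (-1) = J := if_neg (by decide)

theorem isSymmetric_signOp {J : H →ₗ[ℂ] H} (hJ : J.IsSymmetric) (ε : ℤˣ) :
    (signOp J ε).IsSymmetric := by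
  rcases Int.units_eq_one_or ε with rfl | rfl
  · rw [signOp_one]
    exact LinearMap.IsSymmetric.id
  · rwa [signOp_neg_one]

theorem contract_comp_act_extend (J : H →ₗ[ℂ] H) (x : H) {n : ℕ} (τ : hyperoctahedral n) :
    contract x (Fin.last n) ∘ₗ act J (extend τ) = act J τ ∘ₗ contract x (Fin.last n) := by
  refine PiTensorProduct.ext (MultilinearMap.ext fun (v : Fin (n + 1) → H) => ?_)
  simp only [LinearMap.compMultilinearMap_apply, LinearMap.comp_apply, act_tprod, contract_tprod,
    map_smul, ← map_inv, extend_last, Fin.succAbove_last_apply, extend_castSucc, Prod.map_fst,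
    Prod.map_snd, id, signOp_one, LinearMap.id_apply]

theorem contract_comp_act_cosetRep {J : H →ₗ[ℂ] H} (hJ : J.IsSymmetric) (x : H) {n : ℕ}
    (k : Fin (n + 1)) (ε : ℤˣ) :
    contract x (Fin.last n) ∘ₗ act J (cosetRep k ε) = contract (signOp J ε x) k := by
  refine PiTensorProduct.ext (MultilinearMap.ext fun (v : Fin (n + 1) → H) => ?_)
  simp only [LinearMap.compMultilinearMap_apply, LinearMap.comp_apply, act_tprod, contract_tprod,
    cosetRep_inv_last, Fin.succAbove_last_apply, cosetRep_inv_castSucc, one_mul, signOp_one,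
    LinearMap.id_apply, isSymmetric_signOp hJ ε x]

theorem contract_act_extend_mul_cosetRep {J : H →ₗ[ℂ] H} (hJsymm : J.IsSymmetric)
    (hJinv : Function.Involutive J) (x : H) {n : ℕ} (τ : hyperoctahedral n) (k : Fin (n + 1))
    (ε : ℤˣ) (u : ⨂[ℂ]^(n + 1) H) :
    contract x (Fin.last n) (act J (extend τ * cosetRep k ε) u) =
      act J τ (contract (signOp J ε x) k u) := by
  rw [← contract_comp_act_cosetRep hJsymm, act_mul J hJinv]
  exact LinearMap.congr_fun (contract_comp_act_extend J x τ) (act J (cosetRep k ε) u)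

/-- The component `H^{⊗(n+1)} → H^{⊗n}` of the type B annihilation operator of `x`. -/
noncomputable def annihilate (J : H →ₗ[ℂ] H) (α q : ℝ) (x : H) (n : ℕ) :
    (⨂[ℂ]^(n + 1) H) →ₗ[ℂ] (⨂[ℂ]^n H) :=
  ∑ k : Fin (n + 1), ((q : ℂ) ^ (n - k.val) • contract x k +
    ((α : ℂ) * (q : ℂ) ^ (n + k.val)) • contract (J x) k)

theorem contract_symmetrizer {J : H →ₗ[ℂ] H} (hJsymm : J.IsSymmetric)
    (hJinv : Function.Involutive J) (α q : ℝ) (x : H) {n : ℕ} (u : ⨂[ℂ]^(n + 1) H) :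
    contract x (Fin.last n) (symmetrizer J α q (n + 1) u) =
      symmetrizer J α q n (annihilate J α q x n u) := by
  calc contract x (Fin.last n) (symmetrizer J α q (n + 1) u)
      = ∑ τ : hyperoctahedral n, ∑ k : Fin (n + 1), ∑ ε : ℤˣ,
          ((weight α q (extend τ * cosetRep k ε) : ℝ) : ℂ) •
            act J τ (contract (signOp J ε x) k u) := by
        simp only [symmetrizer_eq, LinearMap.sum_apply, LinearMap.smul_apply, map_sum, map_smul,
          ← (Equiv.ofBijective _ extend_mul_cosetRep_bijective).sum_comp, Fintype.sum_prod_type,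
          Equiv.ofBijective_apply, contract_act_extend_mul_cosetRep hJsymm hJinv]
    _ = ∑ τ : hyperoctahedral n, ((weight α q τ : ℝ) : ℂ) • act J τ (annihilate J α q x n u) := by
        simp only [UnitsInt.univ, Finset.sum_pair (show (1 : ℤˣ) ≠ -1 by decide),
          weight_extend_mul_cosetRep_one, weight_extend_mul_cosetRep_neg_one, signOp_one,
          signOp_neg_one, LinearMap.id_apply, annihilate, LinearMap.sum_apply, LinearMap.add_apply,
          LinearMap.smul_apply, map_sum, map_add, map_smul, Finset.smul_sum, smul_add, smul_smul,
          Complex.ofReal_mul, Complex.ofReal_pow]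
    _ = symmetrizer J α q n (annihilate J α q x n u) := by
        simp only [symmetrizer_eq, LinearMap.sum_apply, LinearMap.smul_apply]

theorem lowering_lof_zero (D : ∀ n : ℕ, (⨂[ℂ]^(n + 1) H) →ₗ[ℂ] (⨂[ℂ]^n H)) (u : ⨂[ℂ]^0 H) :
    lowering D (DirectSum.lof ℂ ℕ (fun n => ⨂[ℂ]^n H) 0 u) = 0 := by
  rw [lowering, DirectSum.toModule_lof]
  rfl

theorem lowering_lof_succ (D : ∀ n : ℕ, (⨂[ℂ]^(n + 1) H) →ₗ[ℂ] (⨂[ℂ]^n H)) (n : ℕ)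
    (u : ⨂[ℂ]^(n + 1) H) :
    lowering D (DirectSum.lof ℂ ℕ (fun n => ⨂[ℂ]^n H) (n + 1) u) =
      DirectSum.lof ℂ ℕ (fun n => ⨂[ℂ]^n H) n (D n u) := by
  rw [lowering, DirectSum.toModule_lof]
  rfl

theorem fock_ext {S T : Fock H →ₗ[ℂ] Fock H}
    (h0 : ∀ u, S (DirectSum.lof ℂ ℕ (fun n => ⨂[ℂ]^n H) 0 u) =
      T (DirectSum.lof ℂ ℕ (fun n => ⨂[ℂ]^n H) 0 u))
    (h1 : ∀ n u, S (DirectSum.lof ℂ ℕ (fun n => ⨂[ℂ]^n H) (n + 1) u) =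
      T (DirectSum.lof ℂ ℕ (fun n => ⨂[ℂ]^n H) (n + 1) u)) : S = T := by
  refine DirectSum.linearMap_ext ℂ fun n => LinearMap.ext fun u => ?_
  cases n with
  | zero => exact h0 u
  | succ n => exact h1 n u

theorem lowering_apply (D : ∀ n : ℕ, (⨂[ℂ]^(n + 1) H) →ₗ[ℂ] (⨂[ℂ]^n H)) (g : Fock H) (n : ℕ) :
    lowering D g n = D n (g (n + 1)) := by
  suffices h : DirectSum.component ℂ ℕ (fun n => ⨂[ℂ]^n H) n ∘ₗ lowering D =
      D n ∘ₗ DirectSum.component ℂ ℕ (fun n => ⨂[ℂ]^n H) (n + 1) from LinearMap.congr_fun h g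
  refine DirectSum.linearMap_ext ℂ fun m => LinearMap.ext fun u => ?_
  simp only [LinearMap.comp_apply]
  cases m with
  | zero => rw [lowering_lof_zero, map_zero, DirectSum.component.of, dif_neg (by omega), map_zero]
  | succ m =>
    rw [lowering_lof_succ, DirectSum.component.of, DirectSum.component.of]
    obtain rfl | hne := eq_or_ne m n
    · rw [dif_pos rfl, dif_pos rfl]
    · rw [dif_neg hne, dif_neg (by omega), map_zero]

theorem creation_lof (x : H) (n : ℕ) (u : ⨂[ℂ]^n H) :
    creation x (DirectSum.lof ℂ ℕ (fun n => ⨂[ℂ]^n H) n u) =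
      DirectSum.lof ℂ ℕ (fun n => ⨂[ℂ]^n H) (n + 1) (appendRight x n u) := by
  rw [creation, DirectSum.toModule_lof, LinearMap.comp_apply]

theorem creation_apply_zero (x : H) (f : Fock H) : creation x f 0 = 0 := by
  suffices h : DirectSum.component ℂ ℕ (fun n => ⨂[ℂ]^n H) 0 ∘ₗ creation x = 0 from
    LinearMap.congr_fun h f
  refine DirectSum.linearMap_ext ℂ fun m => LinearMap.ext fun u => ?_
  simp only [LinearMap.comp_apply, creation_lof, LinearMap.zero_apply]
  rw [DirectSum.component.of, dif_neg (by omega)]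

theorem creation_apply_succ (x : H) (f : Fock H) (n : ℕ) :
    creation x f (n + 1) = appendRight x n (f n) := by
  suffices h : DirectSum.component ℂ ℕ (fun n => ⨂[ℂ]^n H) (n + 1) ∘ₗ creation x =
      appendRight x n ∘ₗ DirectSum.component ℂ ℕ (fun n => ⨂[ℂ]^n H) n from
    LinearMap.congr_fun h f
  refine DirectSum.linearMap_ext ℂ fun m => LinearMap.ext fun u => ?_
  simp only [LinearMap.comp_apply, creation_lof]
  rw [DirectSum.component.of, DirectSum.component.of]
  obtain rfl | hne := eq_or_ne m n
  · rw [dif_pos rfl, dif_pos rfl]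
  · rw [dif_neg hne, dif_neg (by omega), map_zero]

theorem fockInner_eq_sum (J : H →ₗ[ℂ] H) (α q : ℝ) {f : Fock H} (g : Fock H) {s : Finset ℕ}
    (hs : ∀ n, n ∉ s → f n = 0) :
    fockInner J α q f g = ∑ n ∈ s, tensorInner n (f n) (symmetrizer J α q n (g n)) := by
  classical
  unfold fockInner
  refine Finset.sum_subset (fun n hn => ?_) (fun n _ hn => ?_)
  · exact not_not.1 (mt (hs n) (DFinsupp.mem_support_iff.1 hn))
  · rw [DFinsupp.notMem_support_iff.1 hn, map_zero, LinearMap.zero_apply]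

theorem isAnnihilation_lowering {J : H →ₗ[ℂ] H} (hJsymm : J.IsSymmetric)
    (hJinv : Function.Involutive J) (α q : ℝ) (x : H) :
    IsAnnihilation J α q x (lowering (annihilate J α q x)) := by
  classical
  intro f g
  obtain ⟨N, hN⟩ := (DFinsupp.support f).exists_nat_subset_range
  have hf (n : ℕ) (hn : n ∉ Finset.range N) : f n = 0 :=
    DFinsupp.notMem_support_iff.1 fun hmem => hn (hN hmem)
  have hcreation (n : ℕ) (hn : n ∉ Finset.range (N + 1)) : creation x f n = 0 := by
    cases n with
    | zero => exact creation_apply_zero x f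
    | succ n =>
      rw [creation_apply_succ, hf n (by simpa using hn), map_zero]
  rw [fockInner_eq_sum J α q _ hf, fockInner_eq_sum J α q g hcreation, Finset.sum_range_succ',
    creation_apply_zero, map_zero, LinearMap.zero_apply, add_zero]
  refine Finset.sum_congr rfl fun n _ => ?_
  rw [lowering_apply, creation_apply_succ, tensorInner_appendRight,
    contract_symmetrizer hJsymm hJinv]

theorem fockInner_lof (J : H →ₗ[ℂ] H) (α q : ℝ) (n : ℕ) (u : ⨂[ℂ]^n H) (g : Fock H) :
    fockInner J α q (DirectSum.lof ℂ ℕ (fun n => ⨂[ℂ]^n H) n u) g =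
      tensorInner n u (symmetrizer J α q n (g n)) := by
  rw [fockInner_eq_sum J α q g (s := {n}), Finset.sum_singleton, DirectSum.lof_apply]
  exact fun m hm => DirectSum.of_eq_of_ne _ _ _ (Finset.notMem_singleton.1 hm)

theorem eq_of_fockInner_eq {J : H →ₗ[ℂ] H} (hJ : Function.Involutive J) {α q : ℝ}
    (hα : |α| < 1) (hq : |q| < 1) {g h : Fock H}
    (hgh : ∀ f, fockInner J α q f g = fockInner J α q f h) : g = h := by
  refine DFinsupp.ext fun n => symmetrizer_injective hJ hα hq n (sub_eq_zero.1 ?_)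
  refine eq_zero_of_tensorInner_eq_zero fun u => ?_
  rw [map_sub, ← fockInner_lof, ← fockInner_lof, hgh, sub_self]

theorem isAnnihilation_iff {J : H →ₗ[ℂ] H} (hJsymm : J.IsSymmetric)
    (hJinv : Function.Involutive J) {α q : ℝ} (hα : |α| < 1) (hq : |q| < 1) (x : H)
    (T : Fock H →ₗ[ℂ] Fock H) :
    IsAnnihilation J α q x T ↔ T = lowering (annihilate J α q x) := by
  constructor
  · intro hT
    refine LinearMap.ext fun g => eq_of_fockInner_eq hJinv hα hq fun f => ?_
    rw [hT f g, isAnnihilation_lowering hJsymm hJinv α q x f g]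
  · rintro rfl
    exact isAnnihilation_lowering hJsymm hJinv α q x

theorem qPowNumberSubOne_lof (q : ℝ) (n : ℕ) (u : ⨂[ℂ]^n H) :
    qPowNumberSubOne H q (DirectSum.lof ℂ ℕ (fun n => ⨂[ℂ]^n H) n u) =
      (q : ℂ) ^ ((n : ℤ) - 1) • DirectSum.lof ℂ ℕ (fun n => ⨂[ℂ]^n H) n u := by
  rw [qPowNumberSubOne, numberFun, DirectSum.toModule_lof, LinearMap.smul_apply]

theorem lowering_comp_qPowNumberSubOne (D : ∀ n : ℕ, (⨂[ℂ]^(n + 1) H) →ₗ[ℂ] (⨂[ℂ]^n H)) (q : ℝ) :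
    lowering D ∘ₗ qPowNumberSubOne H q = lowering fun n => (q : ℂ) ^ n • D n := by
  refine fock_ext (fun u => ?_) (fun n u => ?_)
  · rw [LinearMap.comp_apply, qPowNumberSubOne_lof, map_smul, lowering_lof_zero, lowering_lof_zero,
      smul_zero]
  · rw [LinearMap.comp_apply, qPowNumberSubOne_lof, map_smul, lowering_lof_succ, lowering_lof_succ,
      LinearMap.smul_apply, map_smul, Nat.cast_succ, add_sub_cancel_right, zpow_natCast]

theorem lowering_add_smul (D E : ∀ n : ℕ, (⨂[ℂ]^(n + 1) H) →ₗ[ℂ] (⨂[ℂ]^n H)) (c : ℂ) :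
    lowering D + c • lowering E = lowering fun n => D n + c • E n := by
  refine fock_ext (fun u => ?_) (fun n u => ?_)
  · simp only [LinearMap.add_apply, LinearMap.smul_apply, lowering_lof_zero, smul_zero, add_zero]
  · simp only [LinearMap.add_apply, LinearMap.smul_apply, lowering_lof_succ, map_add, map_smul]

theorem lowering_annihilate (J : H →ₗ[ℂ] H) (α q : ℝ) (x : H) :
    lowering (annihilate J α q x) = rightAnnihilation q x +
      (α : ℂ) • (leftAnnihilation q (J x) ∘ₗ qPowNumberSubOne H q) := by
  rw [rightAnnihilation, leftAnnihilation, lowering_comp_qPowNumberSubOne, lowering_add_smul]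
  congr 1
  funext n
  simp only [annihilate, Finset.sum_add_distrib, Finset.smul_sum, smul_smul, pow_add]

theorem rightAnnihilation_zero (x : H) : rightAnnihilation 0 x = freeRight x := by
  rw [rightAnnihilation, freeRight]
  congr 1
  funext n
  rw [Fin.sum_univ_castSucc, Fin.val_last, Nat.sub_self, pow_zero, one_smul, add_eq_right]
  refine Finset.sum_eq_zero fun k _ => ?_
  rw [Complex.ofReal_zero, Fin.val_castSucc, zero_pow (Nat.sub_ne_zero_of_lt k.isLt), zero_smul]

theorem leftAnnihilation_zero (x : H) : leftAnnihilation 0 x = freeLeft x := by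
  rw [leftAnnihilation, freeLeft]
  congr 1
  funext n
  rw [Fin.sum_univ_succ, Fin.val_zero, pow_zero, one_smul, add_eq_left]
  refine Finset.sum_eq_zero fun k _ => ?_
  rw [Complex.ofReal_zero, Fin.val_succ, zero_pow (Nat.succ_ne_zero _), zero_smul]

theorem leftAnnihilation_eq {q : ℝ} (hq : q ≠ 0) (x : H) :
    leftAnnihilation q x = rightAnnihilation (1 / q) x ∘ₗ qPowNumberSubOne H q := by
  rw [leftAnnihilation, rightAnnihilation, lowering_comp_qPowNumberSubOne]
  congr 1
  funext n
  rw [Finset.smul_sum]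
  refine Finset.sum_congr rfl fun k _ => ?_
  have hpow : (q : ℂ) ^ n = q ^ k.val * q ^ (n - k.val) := by
    rw [← pow_add, Nat.add_sub_cancel' k.is_le]
  rw [smul_smul, hpow, mul_assoc, ← mul_pow, ← Complex.ofReal_mul, mul_one_div_cancel hq,
    Complex.ofReal_one, one_pow, mul_one]

end Fock

end TypeB

theorem mainTheorem4 {H : Type*} [NormedAddCommGroup H] [InnerProductSpace ℂ H]
    (J : H →ₗ[ℂ] H) (hJsymm : J.IsSymmetric) (hJinv : Function.Involutive J)
    (α q : ℝ) (hα : α ∈ Set.Ioo (-1 : ℝ) 1) (hq : q ∈ Set.Ioo (-1 : ℝ) 1) (x : H) :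
    (∀ T : TypeB.Fock H →ₗ[ℂ] TypeB.Fock H,
      TypeB.IsAnnihilation J α q x T ↔
        T = TypeB.rightAnnihilation q x +
          (α : ℂ) • (TypeB.leftAnnihilation q (J x) ∘ₗ TypeB.qPowNumberSubOne H q)) ∧
    TypeB.rightAnnihilation 0 x = TypeB.freeRight x ∧
    TypeB.leftAnnihilation 0 x = TypeB.freeLeft x ∧
    (q ≠ 0 → TypeB.leftAnnihilation q x =
      TypeB.rightAnnihilation (1 / q) x ∘ₗ TypeB.qPowNumberSubOne H q) := by
  refine ⟨fun T => ?_, TypeB.rightAnnihilation_zero x, TypeB.leftAnnihilation_zero x,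
    fun h => TypeB.leftAnnihilation_eq h x⟩
  rw [TypeB.isAnnihilation_iff hJsymm hJinv (abs_lt.2 hα) (abs_lt.2 hq), TypeB.lowering_annihilate]
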